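/- Work over $\mathbb{C}$. Let $V$ be a vector space with basis $x_1,\dots,x_7$, let $$\omega_0=x_1\wedge x_2\wedge x_3\wedge x_7+x_4\wedge x_5\wedge x_6\wedge x_7+x_2\wedge x_3\wedge x_5\wedge x_6+x_1\wedge x_3\wedge x_4\wedge x_6\in\bigwedge^4V,$$ and let $\hat G_2=\{[v\wedge w]\in G(2,V)\mid v\wedge w\wedge\omega_0=0\}$, a subset of $\mathbb{P}(\bigwedge^2V)$ by the Plücker embedding. Let $F\subset\hat G_2$ be the set of those $[v\wedge w]\in\hat G_2$ with $v,w\in\langle x_2,x_3,x_4,x_6,x_7\rangle$ (it is known to be a smooth Fano fourfold; this is not part of the claim). Let $W\subset\bigwedge^2V$ be the linear span of $\hat G_2$ and $\langle F\rangle\subset W$ the linear span of $F$. Then: 1. $\dim W/\langle F\rangle=6$, so that the linear projection from $F$, that is, the map $\pi:\mathbb{P}(W)\dashrightarrow\mathbb{P}(W/\langle F\rangle)$ induced by the quotient map, has target $\mathbb{P}(W/\langle F\rangle)\cong\mathbb{P}^5$. 2. Under any linear identification $\mathbb{P}(W/\langle F\rangle)\cong\mathbb{P}^5$, the subset $\hat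 G_2\subset\mathbb{P}(W)$ is a (closed, irreducible) projective variety and $\pi|_{\hat G_2}:\hat G_2\dashrightarrow\mathbb{P}^5$ is a birational map. There are a twisted cubic $C\subset\mathbb{P}^5$ and a linear isomorphism $H^0(\mathbb{P}^5,\mathcal{I}_C(2))^*\cong W$ such that the inverse of this birational map is the rational map $\varphi:\mathbb{P}^5\dashrightarrow\mathbb{P}(H^0(\mathbb{P}^5,\mathcal{I}_C(2))^*)\cong\mathbb{P}(W)$ given by the complete linear system of quadrics containing $C$. 3. For this $\varphi$, $\hat G_2$ is the Zariski closure in $\mathbb{P}(W)$ of the image under $\varphi$ of the set of points of $\mathbb{P}^5$ at which these quadrics do not all vanish. -/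

import Mathlib

open scoped LinearAlgebra.Projectivization

noncomputable section

namespace HatG2

section Zariski

variable (E : Type*) [AddCommGroup E] [Module ℂ E]
variable (E' : Type*) [AddCommGroup E'] [Module ℂ E']

/-- The algebra of polynomial functions on a complex vector space: the algebra of functions
generated by the linear forms. -/
def polyFun : Subalgebra ℂ (E → ℂ) :=
  Algebra.adjoin ℂ (Set.range fun l : Module.Dual ℂ E => (l : E → ℂ))

variable {E E'}

/-- `f` is a form (homogeneous polynomial function) of degree `d`. -/
def IsForm (d : ℕ) (f : E → ℂ) : Prop :=
  f ∈ polyFun E ∧ ∀ (c : ℂ) (x : E), f (c • x) = c ^ d * f x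

/-- `f : E → E'` has as components forms of the same degree `d`; such an `f` represents a
rational map from (subvarieties of) `ℙ E` to `ℙ E'`. -/
def IsFormMap (d : ℕ) (f : E → E') : Prop :=
  ∀ l : Module.Dual ℂ E', IsForm d fun x => l (f x)

variable (E) in
/-- The Zariski topology on the projective space `ℙ E`, generated by the complements of the
zero loci of forms. -/
@[reducible]
def zariski : TopologicalSpace (ℙ ℂ E) :=
  TopologicalSpace.generateFrom
    {U | ∃ (d : ℕ) (f : E → ℂ), IsForm d f ∧ U = {p : ℙ ℂ E | f p.rep ≠ 0}}

/-- A projective variety: a Zariski closed and irreducible subset of `ℙ E`. -/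
def IsProjVariety (X : Set (ℙ ℂ E)) : Prop :=
  @IsClosed _ (zariski E) X ∧ @IsIrreducible _ (zariski E) X

/-- The rational map represented by `f` is defined by `f` at `p` and sends `p` to `q`. -/
def Sends (f : E → E') (p : ℙ ℂ E) (q : ℙ ℂ E') : Prop :=
  ∃ h : f p.rep ≠ 0, Projectivization.mk ℂ (f p.rep) h = q

/-- `f` and `g` represent mutually inverse birational maps between the projective varieties
`X` and `Y`: there are non-empty (hence dense) open subsets of `X` and of `Y` on which they are
defined and which they map to each other by mutually inverse bijections. -/
structure BirationalInverse (X : Set (ℙ ℂ E)) (Y : Set (ℙ ℂ E')) (f : E → E') (g : E' → E) :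
    Prop where
  source : IsProjVariety X
  target : IsProjVariety Y
  form : ∃ d : ℕ, IsFormMap d f
  form_inv : ∃ d : ℕ, IsFormMap d g
  exists_open : ∃ (U : Set (ℙ ℂ E)) (U' : Set (ℙ ℂ E')),
    @IsOpen _ (zariski E) U ∧ @IsOpen _ (zariski E') U' ∧
    (X ∩ U).Nonempty ∧ (Y ∩ U').Nonempty ∧
    (∀ p ∈ X ∩ U, ∃ q ∈ Y ∩ U', Sends f p q ∧ Sends g q p) ∧
    (∀ q ∈ Y ∩ U', ∃ p ∈ X ∩ U, Sends g q p ∧ Sends f p q)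

/-- The linear span (as a linear subspace of `E`) of a subset of `ℙ E`. -/
def linSpan (S : Set (ℙ ℂ E)) : Submodule ℂ E :=
  ⨆ p ∈ S, p.submodule

end Zariski

section Variety

/-- The seven-dimensional space, with standard basis `x₁, …, x₇` (indexed here by `0, …, 6`). -/
abbrev V : Type := Fin 7 → ℂ

/-- The `i`-th basis vector in the exterior algebra of `V`, for `i = 1, …, 7`
(numbered as `0, …, 6`). -/
def x (i : Fin 7) : ExteriorAlgebra ℂ V := ExteriorAlgebra.ι ℂ (Pi.single i 1)

/-- The general degenerate four-form `x₁∧x₂∧x₃∧x₇ + x₄∧x₅∧x₆∧x₇ + x₂∧x₃∧x₅∧x₆ + x₁∧x₃∧x₄∧x₆`. -/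
def omega0 : ExteriorAlgebra ℂ V :=
  x 0 * x 1 * x 2 * x 6 + x 3 * x 4 * x 5 * x 6 + x 1 * x 2 * x 4 * x 5 + x 0 * x 2 * x 3 * x 5

/-- The product `v ∧ w` in the exterior algebra. -/
def wedge (v w : V) : ExteriorAlgebra ℂ V := ExteriorAlgebra.ι ℂ v * ExteriorAlgebra.ι ℂ w

/-- The second exterior power of `V`. -/
def Bivec : Type := ⋀[ℂ]^2 V

instance : AddCommGroup Bivec := inferInstanceAs (AddCommGroup (⋀[ℂ]^2 V))

instance : Module ℂ Bivec := inferInstanceAs (Module ℂ (⋀[ℂ]^2 V))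

/-- The inclusion of the second exterior power in the exterior algebra. -/
def Bivec.toExt : Bivec →ₗ[ℂ] ExteriorAlgebra ℂ V := Submodule.subtype (⋀[ℂ]^2 V)

/-- The points `[v ∧ w]` of `G(2, V)`, in its Plücker embedding, with `v ∧ w ∧ ω₀ = 0`. -/
def Ghat : Set (ℙ ℂ Bivec) :=
  {p | ∃ v w : V, p.rep.toExt = wedge v w ∧ wedge v w * omega0 = 0}

/-- The fourfold in `Ghat` of the points `[v ∧ w]` with `v, w` in the span of
`x₂, x₃, x₄, x₆, x₇`. -/
def F : Set (ℙ ℂ Bivec) :=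
  {p | ∃ v w : V, (v 0 = 0 ∧ v 4 = 0) ∧ (w 0 = 0 ∧ w 4 = 0) ∧
    p.rep.toExt = wedge v w ∧ wedge v w * omega0 = 0}

/-- The linear span of `Ghat`. -/
abbrev W : Submodule ℂ Bivec := linSpan Ghat

/-- `Ghat` as a subset of the projective space of its linear span. -/
def GhatW : Set (ℙ ℂ W) :=
  {p | Projectivization.map W.subtype W.injective_subtype p ∈ Ghat}

/-- The centre of the projection: the linear span of `F`, inside the linear span of `Ghat`. -/
abbrev spanF : Submodule ℂ W := (linSpan F).comap W.subtype

/-- The linear projection from (the linear span of) `F`, in linear coordinates `θ` on its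
target. -/
def projF (θ : (W ⧸ spanF) ≃ₗ[ℂ] (Fin 6 → ℂ)) : W → (Fin 6 → ℂ) :=
  fun y => θ (spanF.mkQ y)

end Variety

section Quadrics

/-- `C ⊆ ℙ⁵` is a twisted cubic: in suitable coordinates on a three-dimensional linear subspace
it is the image of `[s : t] ↦ [s³ : s²t : st² : t³]`. -/
def IsTwistedCubic (C : Set (ℙ ℂ (Fin 6 → ℂ))) : Prop :=
  ∃ v : Fin 4 → (Fin 6 → ℂ), LinearIndependent ℂ v ∧
    C = {p | ∃ (s t : ℂ)
      (h : s ^ 3 • v 0 + (s ^ 2 * t) • v 1 + (s * t ^ 2) • v 2 + t ^ 3 • v 3 ≠ 0),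
      Projectivization.mk ℂ _ h = p}

/-- The complete linear system of quadrics in `ℙ⁵` containing `C`. -/
def quadrics (C : Set (ℙ ℂ (Fin 6 → ℂ))) : Submodule ℂ (MvPolynomial (Fin 6) ℂ) :=
  MvPolynomial.homogeneousSubmodule (Fin 6) ℂ 2 ⊓
    ⨅ p ∈ C, LinearMap.ker (MvPolynomial.aeval (R := ℂ) p.rep).toLinearMap

/-- Evaluation of the quadrics containing `C` at a vector; this represents the rational map
`ℙ⁵ ⇢ ℙ(H⁰(L)^*)` given by the linear system `L` of these quadrics. -/
def quadricMap (C : Set (ℙ ℂ (Fin 6 → ℂ))) (y : Fin 6 → ℂ) : Module.Dual ℂ (quadrics C) :=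
  (MvPolynomial.aeval (R := ℂ) y).toLinearMap ∘ₗ (quadrics C).subtype

/-- The map given by the quadrics containing `C`, with the target of the linear system identified
with the linear span of `Ghat` by a linear isomorphism `β`. -/
def phi (C : Set (ℙ ℂ (Fin 6 → ℂ))) (β : Module.Dual ℂ (quadrics C) ≃ₗ[ℂ] W) :
    (Fin 6 → ℂ) → W :=
  fun y => β (quadricMap C y)

end Quadrics

end HatG2

end

/-!
Write `p₁₂, …, p₆₇` for the Plücker coordinates of a bivector; indices start with 1 in comments and
with 0 in the code, so that `p₁₅` is `pl 0 4`. The condition `v ∧ w ∧ ω₀ = 0` amounts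
to seven linear equations (`wedge_mul_omega0`)
`p₁₂ = p₄₅ = p₂₃ + p₄₇ = p₁₃ - p₅₇ = p₅₆ + p₁₇ = p₄₆ - p₂₇ = p₁₄ + p₂₅ = 0`,
which also define the span `W` of `Ghat` (`W_eq_adm`), of dimension 14; the span of `F` is cut out
in `W` by the vanishing of `p₁₃, p₁₄, p₁₅, p₁₆, p₁₇, p₃₅` (`mem_linSpan_F_iff`). These six
coordinates therefore describe the projection `pi0` from `F`.

A plane in `Ghat` with `p₁₅ = 1` has a unique basis in echelon form with respect to `x₁, x₅`, and the
linear equations determine it by the other five of the six coordinates: homogenized, this is the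
quadratic map `phi0`, with `pi0 (phi0 y) = p₁₅ y` (`pi0_phi0`) and `phi0 (pi0 b) = p₁₅ b` on the cone
over `Ghat` (`IsCone.phi0_pi0`). The components of `phi0` are `p₁₅` times each coordinate, `p₁₄` times
each coordinate, and three more quadrics in `p₁₃, p₁₆, p₁₇, p₃₅`, which are the minors defining a
twisted cubic in `p₁₄ = p₁₅ = 0`. A comparison of coefficients on the cubic shows that these are all
quadrics through the cubic (`exists_dual_of_bilin`, `range_dualToFun`), so that `phi0` is the map
given by the complete linear system.

It remains to see that the points with `p₁₅ ≠ 0` are dense in `Ghat` (`represents_of_isCone`); then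
`Ghat`, which is closed by the Plücker relations, is the closure of an image of `ℙ⁵`, hence
irreducible. Every other point of `Ghat` is a limit along an explicit curve, in three stages: a
one-parameter group preserving `Ghat` handles the planes with `p₁₄` or `p₂₄` non-zero
(`represents_of_minor_ne_zero`); the other planes not contained in `⟨x₃, x₆, x₇⟩` contain a vector `w`
of this space, and `w` can be moved out of it along a line with the other vector fixed
(`represents_of_right_mem`); a plane in
`⟨x₃, x₆, x₇⟩` meets the conic on which `w` admits a partner outside of this space
(`represents_of_mem`).
-/

noncomputable section

namespace HatG2

/-! ### Curves, forms and the Zariski topology -/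

section ZariskiGeneral

open Filter

variable {E : Type*} [AddCommGroup E] [Module ℂ E]
variable {E' : Type*} [AddCommGroup E'] [Module ℂ E']

/-- A curve in `E` all of whose linear coordinates are polynomials in the parameter. -/
def IsPolyCurve (γ : ℂ → E) : Prop :=
  ∀ l : Module.Dual ℂ E, ∃ P : Polynomial ℂ, ∀ t, l (γ t) = P.eval t

lemma dual_mem_polyFun (l : Module.Dual ℂ E) : (l : E → ℂ) ∈ polyFun E :=
  Algebra.subset_adjoin ⟨l, rfl⟩

lemma IsPolyCurve.exists_eval {γ : ℂ → E} (hγ : IsPolyCurve γ) {f : E → ℂ}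
    (hf : f ∈ polyFun E) : ∃ P : Polynomial ℂ, ∀ t, f (γ t) = P.eval t := by
  induction hf using Algebra.adjoin_induction with
  | mem f hf => obtain ⟨l, rfl⟩ := hf; exact hγ l
  | algebraMap r => exact ⟨Polynomial.C r, fun t => by simp⟩
  | add f g _ _ hf hg =>
    obtain ⟨P, hP⟩ := hf
    obtain ⟨Q, hQ⟩ := hg
    exact ⟨P + Q, fun t => by simp [hP, hQ]⟩
  | mul f g _ _ hf hg =>
    obtain ⟨P, hP⟩ := hf
    obtain ⟨Q, hQ⟩ := hg
    exact ⟨P * Q, fun t => by simp [hP, hQ]⟩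

lemma IsPolyCurve.eventually_apply_ne_zero {γ : ℂ → E} (hγ : IsPolyCurve γ) {f : E → ℂ}
    (hf : f ∈ polyFun E) {t₀ : ℂ} (h : f (γ t₀) ≠ 0) : ∀ᶠ t in cofinite, f (γ t) ≠ 0 := by
  obtain ⟨P, hP⟩ := hγ.exists_eval hf
  have hP0 : P ≠ 0 := by
    rintro rfl
    exact h (by simp [hP])
  rw [eventually_cofinite]
  refine (P.roots.toFinset.finite_toSet).subset fun t ht => ?_
  simpa [hP0, hP] using ht

lemma IsPolyCurve.eventually_ne_zero {γ : ℂ → E} (hγ : IsPolyCurve γ) {t₀ : ℂ}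
    (h : γ t₀ ≠ 0) : ∀ᶠ t in cofinite, γ t ≠ 0 := by
  obtain ⟨l, hl⟩ : ∃ l : Module.Dual ℂ E, l (γ t₀) ≠ 0 := by
    by_contra! hl
    exact h ((Module.forall_dual_apply_eq_zero_iff ℂ _).1 hl)
  filter_upwards [hγ.eventually_apply_ne_zero (dual_mem_polyFun l) hl] with t ht h0
  exact ht (by simp [h0])

lemma isPolyCurve_line (a b : E) : IsPolyCurve fun t : ℂ => a + t • b := fun l =>
  ⟨Polynomial.C (l a) + Polynomial.C (l b) * Polynomial.X, fun t => by simp [mul_comm t]⟩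

lemma IsForm.mul {d e : ℕ} {f g : E → ℂ} (hf : IsForm d f) (hg : IsForm e g) :
    IsForm (d + e) (f * g) :=
  ⟨(polyFun E).mul_mem hf.1 hg.1, fun c x => by simp only [Pi.mul_apply, hf.2, hg.2]; ring⟩

lemma isForm_dual (l : Module.Dual ℂ E) : IsForm 1 (l : E → ℂ) :=
  ⟨dual_mem_polyFun l, fun c x => by simp⟩

lemma IsForm.rep_mk_ne_zero_iff {d : ℕ} {f : E → ℂ} (hf : IsForm d f) {b : E} (hb : b ≠ 0) :
    f (Projectivization.mk ℂ b hb).rep ≠ 0 ↔ f b ≠ 0 := by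
  obtain ⟨a, ha⟩ := Projectivization.exists_smul_eq_mk_rep ℂ b hb
  rw [← ha, Units.smul_def, hf.2]
  simp

lemma IsFormMap.smul {d : ℕ} {g : E → E'} (hg : IsFormMap d g) (c : ℂ) (x : E) :
    g (c • x) = c ^ d • g x := by
  rw [← sub_eq_zero, ← Module.forall_dual_apply_eq_zero_iff ℂ]
  intro l
  rw [map_sub, map_smul, sub_eq_zero]
  exact (hg l).2 c x

lemma IsForm.isOpen {d : ℕ} {f : E → ℂ} (hf : IsForm d f) :
    @IsOpen _ (zariski E) {p : ℙ ℂ E | f p.rep ≠ 0} :=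
  TopologicalSpace.isOpen_generateFrom_of_mem ⟨d, f, hf, rfl⟩

lemma IsForm.isClosed {d : ℕ} {f : E → ℂ} (hf : IsForm d f) :
    @IsClosed _ (zariski E) {p : ℙ ℂ E | f p.rep = 0} := by
  let _ := zariski E
  rw [← isOpen_compl_iff]
  exact hf.isOpen

/-- The complements of the zero loci of forms are a basis, not only a subbasis, of the Zariski
topology, because forms can be multiplied. -/
lemma isTopologicalBasis_zariski : @TopologicalSpace.IsTopologicalBasis _ (zariski E)
    {U | ∃ (d : ℕ) (f : E → ℂ), IsForm d f ∧ U = {p : ℙ ℂ E | f p.rep ≠ 0}} := by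
  let _ := zariski E
  refine ⟨?_, ?_, rfl⟩
  · rintro _ ⟨d, f, hf, rfl⟩ _ ⟨e, g, hg, rfl⟩ p ⟨hpf, hpg⟩
    refine ⟨_, ⟨d + e, f * g, hf.mul hg, rfl⟩, mul_ne_zero hpf hpg, fun q hq => ?_⟩
    exact ⟨left_ne_zero_of_mul hq, right_ne_zero_of_mul hq⟩
  · refine Set.eq_univ_of_forall fun p => ?_
    exact ⟨_, ⟨0, 1, ⟨(polyFun E).one_mem, fun c x => by simp⟩, rfl⟩, by simp⟩

/-- A Zariski closed set that contains almost all points of a polynomial curve contains all of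
them. -/
lemma mk_mem_of_isPolyCurve {Z : Set (ℙ ℂ E)} (hZ : @IsClosed _ (zariski E) Z) {γ : ℂ → E}
    (hγ : IsPolyCurve γ) (h : ∀ᶠ t in cofinite, ∀ ht : γ t ≠ 0, Projectivization.mk ℂ _ ht ∈ Z)
    {t₀ : ℂ} (h₀ : γ t₀ ≠ 0) : Projectivization.mk ℂ _ h₀ ∈ Z := by
  let _ := zariski E
  by_contra hmem
  obtain ⟨_, ⟨d, f, hf, rfl⟩, hp, hsub⟩ :=
    isTopologicalBasis_zariski.exists_subset_of_mem_open (u := Zᶜ) hmem hZ.isOpen_compl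
  have hf₀ := (hf.rep_mk_ne_zero_iff h₀).1 hp
  obtain ⟨t, ht, hft, hne⟩ := (h.and ((hγ.eventually_apply_ne_zero hf.1 hf₀).and
    (hγ.eventually_ne_zero h₀))).exists
  exact hsub ((hf.rep_mk_ne_zero_iff hne).2 hft) (ht hne)

lemma sends_mk_iff {d : ℕ} {g : E → E'} (hg : IsFormMap d g) {y : E} (hy : y ≠ 0)
    {q : ℙ ℂ E'} : Sends g (Projectivization.mk ℂ y hy) q ↔
      ∃ h : g y ≠ 0, Projectivization.mk ℂ (g y) h = q := by
  obtain ⟨a, ha⟩ := Projectivization.exists_smul_eq_mk_rep ℂ y hy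
  have hga : g (Projectivization.mk ℂ y hy).rep = (a : ℂ) ^ d • g y := by
    rw [← ha, Units.smul_def, hg.smul]
  have had : (a : ℂ) ^ d ≠ 0 := pow_ne_zero _ a.ne_zero
  have hmk : ∀ (h : g (Projectivization.mk ℂ y hy).rep ≠ 0) (h' : g y ≠ 0),
      Projectivization.mk ℂ _ h = Projectivization.mk ℂ _ h' := fun h h' =>
    (Projectivization.mk_eq_mk_iff' ..).2 ⟨_, hga.symm⟩
  constructor
  · rintro ⟨h, rfl⟩
    have h' : g y ≠ 0 := fun h0 => h (by rw [hga, h0, smul_zero])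
    exact ⟨h', (hmk h h').symm⟩
  · rintro ⟨h', rfl⟩
    have h : g (Projectivization.mk ℂ y hy).rep ≠ 0 := by
      rw [hga]
      exact smul_ne_zero had h'
    exact ⟨h, hmk h h'⟩

/-- The image of a rational map from a projective space is irreducible: any two of its points
lie on the image of a line, which is a polynomial curve. -/
lemma isIrreducible_image {d : ℕ} {g : E → E'} (hg : IsFormMap d g)
    (hne : ∃ y : E, y ≠ 0 ∧ g y ≠ 0) :
    @IsIrreducible _ (zariski E') {q | ∃ y : ℙ ℂ E, Sends g y q} := by
  let _ := zariski E'
  refine ⟨?_, ?_⟩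
  · obtain ⟨y, hy, hgy⟩ := hne
    exact ⟨_, Projectivization.mk ℂ y hy, (sends_mk_iff hg hy).2 ⟨hgy, rfl⟩⟩
  · rintro U U' hU hU' ⟨_, ⟨y, hgy, rfl⟩, hyU⟩ ⟨_, ⟨z, hgz, rfl⟩, hzU⟩
    obtain ⟨_, ⟨e, f, hf, rfl⟩, hyf, hsub⟩ :=
      isTopologicalBasis_zariski.exists_subset_of_mem_open hyU hU
    obtain ⟨_, ⟨e', f', hf', rfl⟩, hzf, hsub'⟩ :=
      isTopologicalBasis_zariski.exists_subset_of_mem_open hzU hU'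
    replace hyf := (hf.rep_mk_ne_zero_iff hgy).1 hyf
    replace hzf := (hf'.rep_mk_ne_zero_iff hgz).1 hzf
    have hline := isPolyCurve_line y.rep (z.rep - y.rep)
    have hcurve : IsPolyCurve fun t : ℂ => g (y.rep + t • (z.rep - y.rep)) := fun l =>
      hline.exists_eval (hg l).1
    obtain ⟨t, h1, h2, h3, h4⟩ :=
      ((hline.eventually_ne_zero (t₀ := 0) (by simpa using y.rep_nonzero)).and
      ((hcurve.eventually_ne_zero (t₀ := 0) (by simpa using hgy)).and
      ((hcurve.eventually_apply_ne_zero hf.1 (t₀ := 0) (by simpa using hyf)).and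
      (hcurve.eventually_apply_ne_zero hf'.1 (t₀ := 1) (by simpa using hzf))))).exists
    refine ⟨_, ⟨_, (sends_mk_iff hg h1).2 ⟨h2, rfl⟩⟩, ?_⟩
    exact ⟨hsub ((hf.rep_mk_ne_zero_iff h2).2 h3), hsub' ((hf'.rep_mk_ne_zero_iff h2).2 h4)⟩

lemma mem_linSpan {S : Set (ℙ ℂ E)} {b : E}
    (h : ∀ hb : b ≠ 0, Projectivization.mk ℂ b hb ∈ S) : b ∈ linSpan S := by
  by_cases hb : b = 0
  · rw [hb]; exact Submodule.zero_mem _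
  · refine (le_iSup₂ (f := fun (p : ℙ ℂ E) (_ : p ∈ S) => p.submodule) _ (h hb)) ?_
    rw [Projectivization.submodule_mk]
    exact Submodule.mem_span_singleton_self b

lemma linSpan_le {S : Set (ℙ ℂ E)} {N : Submodule ℂ E} (h : ∀ p ∈ S, p.rep ∈ N) :
    linSpan S ≤ N := by
  refine iSup₂_le fun p hp => ?_
  rw [Projectivization.submodule_eq, Submodule.span_singleton_le_iff_mem]
  exact h p hp

end ZariskiGeneral

/-! ### Plücker coordinates of bivectors -/

section Coordinates

lemma x_mul_self (i : Fin 7) : x i * x i = 0 := ExteriorAlgebra.ι_sq_zero _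

lemma x_mul_self_left (i : Fin 7) (z : ExteriorAlgebra ℂ V) : x i * (x i * z) = 0 := by
  rw [← mul_assoc, x_mul_self, zero_mul]

lemma x_swap (i j : Fin 7) : x i * x j = -(x j * x i) :=
  eq_neg_of_add_eq_zero_left (ExteriorAlgebra.ι_add_mul_swap _ _)

lemma x_mul_of_lt {i j : Fin 7} (_ : j < i) : x i * x j = -(x j * x i) := x_swap i j

lemma x_mul_left_of_lt {i j : Fin 7} (_ : j < i) (z : ExteriorAlgebra ℂ V) :
    x i * (x j * z) = -(x j * (x i * z)) := by
  rw [← mul_assoc, x_swap, neg_mul, mul_assoc]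

/-- The minors of the pair of vectors `v, w`. -/
def minor (v w : V) (i j : Fin 7) : ℂ := v i * w j - v j * w i

lemma ι_eq_sum (v : V) : ExteriorAlgebra.ι ℂ v = ∑ i, v i • x i := by
  have h : v = ∑ i, v i • Pi.single i (1 : ℂ) := by
    ext k
    simp [Finset.sum_apply, Pi.single_apply]
  conv_lhs => rw [h]
  simp only [x, map_sum, map_smul]

/-- The seven linear equations that the Plücker coordinates of a bivector must satisfy for its
product with `omega0` to vanish. -/
def IsAdm (p : Fin 7 → Fin 7 → ℂ) : Prop :=
  p 0 1 = 0 ∧ p 3 4 = 0 ∧ p 1 2 + p 3 6 = 0 ∧ p 0 2 - p 4 6 = 0 ∧ p 4 5 + p 0 6 = 0 ∧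
    p 3 5 - p 1 6 = 0 ∧ p 0 3 + p 1 4 = 0

set_option maxHeartbeats 1000000 in
/-- The product `v ∧ w ∧ ω₀`, expanded in the products of six of the seven basis vectors. -/
lemma wedge_mul_omega0 (v w : V) : wedge v w * omega0 =
    (minor v w 1 2 + minor v w 3 6) • (x 1 * (x 2 * (x 3 * (x 4 * (x 5 * x 6))))) +
    (minor v w 0 2 - minor v w 4 6) • (x 0 * (x 2 * (x 3 * (x 4 * (x 5 * x 6))))) +
    minor v w 0 1 • (x 0 * (x 1 * (x 3 * (x 4 * (x 5 * x 6))))) +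
    (minor v w 4 5 + minor v w 0 6) • (x 0 * (x 1 * (x 2 * (x 4 * (x 5 * x 6))))) +
    (minor v w 3 5 - minor v w 1 6) • (x 0 * (x 1 * (x 2 * (x 3 * (x 5 * x 6))))) +
    minor v w 3 4 • (x 0 * (x 1 * (x 2 * (x 3 * (x 4 * x 6))))) +
    (minor v w 0 3 + minor v w 1 4) • (x 0 * (x 1 * (x 2 * (x 3 * (x 4 * x 5))))) := by
  have h : wedge v w = ∑ i, ∑ j, (v i * w j) • (x i * x j) := by
    simp only [wedge, ι_eq_sum, Finset.sum_mul_sum, smul_mul_smul_comm]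
  rw [h, Finset.sum_mul]
  simp only [Finset.sum_mul, smul_mul_assoc, omega0, mul_add, mul_assoc]
  simp [Fin.sum_univ_succ, x_mul_self, x_mul_self_left, x_mul_of_lt, x_mul_left_of_lt, minor]
  module

lemma contractLeft_ι_mul (d : Module.Dual ℂ V) (v : V) (z : ExteriorAlgebra ℂ V) :
    CliffordAlgebra.contractLeft d (ExteriorAlgebra.ι ℂ v * z) =
      d v • z - ExteriorAlgebra.ι ℂ v * CliffordAlgebra.contractLeft d z :=
  CliffordAlgebra.contractLeft_ι_mul (d := d) v z

/-- The product of all basis vectors is non-zero: its iterated contraction with the dual basis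
is `1`. -/
lemma top_ne_zero :
    x 0 * (x 1 * (x 2 * (x 3 * (x 4 * (x 5 * x 6))))) ≠ 0 := by
  intro h
  let e (i : Fin 7) : Module.Dual ℂ V := LinearMap.proj i
  have he : ∀ i j, e i (Pi.single j 1) = if i = j then 1 else 0 := fun i j => by
    simp [e, Pi.single_apply]
  have h' := congrArg (fun z => CliffordAlgebra.contractLeft (e 6)
    (CliffordAlgebra.contractLeft (e 5) (CliffordAlgebra.contractLeft (e 4)
    (CliffordAlgebra.contractLeft (e 3) (CliffordAlgebra.contractLeft (e 2)
    (CliffordAlgebra.contractLeft (e 1) (CliffordAlgebra.contractLeft (e 0) z))))))) h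
  simp [x, contractLeft_ι_mul, he] at h'

lemma wedge_mul_omega0_eq_zero_iff (v w : V) :
    wedge v w * omega0 = 0 ↔ IsAdm (minor v w) := by
  constructor
  · intro h
    rw [wedge_mul_omega0] at h
    -- multiplication by `x k` singles out the coefficient of the product without `x k`
    have key := fun k => congrArg (· * x k) h
    have h0 := key 0
    have h1 := key 1
    have h2 := key 2
    have h3 := key 3
    have h4 := key 4
    have h5 := key 5
    have h6 := key 6
    simp [add_mul, mul_assoc, x_mul_self, x_mul_self_left, x_mul_of_lt,
      x_mul_left_of_lt, top_ne_zero] at h0 h1 h2 h3 h4 h5 h6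
    exact ⟨h2, h5, h0, h1, h3, h4, h6⟩
  · rintro ⟨h2, h5, h0, h1, h3, h4, h6⟩
    simp [wedge_mul_omega0, h0, h1, h2, h3, h4, h5, h6]

/-- The Plücker coordinates of a bivector. -/
def pl (i j : Fin 7) : Bivec →ₗ[ℂ] ℂ :=
  (ExteriorAlgebra.algebraMapInv (R := ℂ) (M := V)).toLinearMap ∘ₗ
    CliffordAlgebra.contractLeft (LinearMap.proj j : Module.Dual ℂ V) ∘ₗ
    CliffordAlgebra.contractLeft (LinearMap.proj i : Module.Dual ℂ V) ∘ₗ Bivec.toExt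

lemma Bivec.toExt_injective : Function.Injective Bivec.toExt := Subtype.val_injective

lemma pl_of_toExt_eq {b : Bivec} {v w : V} (h : b.toExt = wedge v w) (i j : Fin 7) :
    pl i j b = minor v w i j := by
  simp [pl, h, wedge, contractLeft_ι_mul, minor]

/-- The bivector `v ∧ w`. -/
def wedgeAux (v w : V) : Bivec :=
  ⟨wedge v w, by
    change wedge v w ∈ LinearMap.range (ExteriorAlgebra.ι ℂ (M := V)) ^ 2
    rw [wedge, pow_two]
    exact Submodule.mul_mem_mul ⟨v, rfl⟩ ⟨w, rfl⟩⟩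

lemma toExt_wedgeAux (v w : V) : (wedgeAux v w).toExt = wedge v w := rfl

/-- The bivector `v ∧ w`, as a bilinear map. -/
def wedgeB : V →ₗ[ℂ] V →ₗ[ℂ] Bivec :=
  LinearMap.mk₂ ℂ wedgeAux
    (fun _ _ _ => Bivec.toExt_injective (by simp [toExt_wedgeAux, wedge, add_mul]))
    (fun _ _ _ => Bivec.toExt_injective (by simp [toExt_wedgeAux, wedge]))
    (fun _ _ _ => Bivec.toExt_injective (by simp [toExt_wedgeAux, wedge, mul_add]))
    (fun _ _ _ => Bivec.toExt_injective (by simp [toExt_wedgeAux, wedge]))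

lemma toExt_wedgeB (v w : V) : (wedgeB v w).toExt = wedge v w := rfl

@[simp] lemma pl_wedgeB (i j : Fin 7) (v w : V) : pl i j (wedgeB v w) = v i * w j - v j * w i :=
  pl_of_toExt_eq (toExt_wedgeB v w) i j

lemma wedgeB_self (v : V) : wedgeB v v = 0 :=
  Bivec.toExt_injective (by rw [toExt_wedgeB, map_zero]; exact ExteriorAlgebra.ι_sq_zero v)

lemma wedgeB_swap (v w : V) : wedgeB v w = -wedgeB w v :=
  Bivec.toExt_injective (by
    rw [map_neg, toExt_wedgeB, toExt_wedgeB]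
    exact eq_neg_of_add_eq_zero_left (ExteriorAlgebra.ι_add_mul_swap _ _))

lemma linearMap_ext {N : Type*} [AddCommGroup N] [Module ℂ N] {f g : Bivec →ₗ[ℂ] N}
    (h : ∀ v w, f (wedgeB v w) = g (wedgeB v w)) : f = g := by
  have key : ∀ a : Fin 2 → V, exteriorPower.ιMulti ℂ 2 a = wedgeB (a 0) (a 1) := fun a =>
    Subtype.ext (by
      rw [exteriorPower.ιMulti_apply_coe, ExteriorAlgebra.ιMulti_apply]
      change _ = wedge (a 0) (a 1)
      simp [wedge])
  refine exteriorPower.linearMap_ext (R := ℂ) (M := V) (n := 2) (f := f) (g := g) ?_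
  ext a
  exact (congrArg f (key a)).trans ((h _ _).trans (congrArg g (key a)).symm)

lemma pl_swap (i j : Fin 7) (b : Bivec) : pl i j b = -pl j i b := by
  have h : pl i j = -pl j i := linearMap_ext fun v w => by simp
  rw [h, LinearMap.neg_apply]

lemma pl_self (i : Fin 7) (b : Bivec) : pl i i b = 0 :=
  self_eq_neg.1 (pl_swap i i b)

lemma sum_smul_wedgeB_single (v w : V) :
    ∑ i, ∑ j, (v i * w j) • wedgeB (Pi.single i 1) (Pi.single j 1) = wedgeB v w := by
  have h : ∀ u : V, u = ∑ i, u i • Pi.single i (1 : ℂ) := fun u => by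
    ext k
    simp [Finset.sum_apply, Pi.single_apply]
  conv_rhs => rw [h v, h w]
  rw [LinearMap.map_sum₂]
  simp only [map_sum, map_smul, LinearMap.smul_apply, mul_smul]
  exact Finset.sum_congr rfl fun i _ => Finset.sum_congr rfl fun j _ => smul_comm _ _ _

lemma two_smul_eq_sum (b : Bivec) :
    (2 : ℂ) • b = ∑ i, ∑ j, pl i j b • wedgeB (Pi.single i 1) (Pi.single j 1) := by
  have h : (2 : ℂ) • LinearMap.id = ∑ i, ∑ j,
      (pl i j).smulRight (wedgeB (Pi.single i 1) (Pi.single j 1)) := linearMap_ext fun v w => by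
    have h1 := sum_smul_wedgeB_single v w
    have h2 := sum_smul_wedgeB_single w v
    simp only [LinearMap.sum_apply, LinearMap.smulRight_apply, pl_wedgeB, sub_smul,
      Finset.sum_sub_distrib, mul_comm (v _) (w _)] at h1 h2 ⊢
    rw [h1, h2, wedgeB_swap w v, sub_neg_eq_add, LinearMap.smul_apply, LinearMap.id_apply,
      two_smul]
  simpa using congrArg (fun f => f b) h

lemma pl_ext {b b' : Bivec} (h : ∀ i j, pl i j b = pl i j b') : b = b' := by
  have h2 : (2 : ℂ) • b = (2 : ℂ) • b' := by simp only [two_smul_eq_sum, h]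
  exact smul_right_injective _ two_ne_zero h2

end Coordinates

/-! ### Linear equations and the rational parametrization -/

section Cone

/-- The linear subspace of the second exterior power cut out by the seven linear equations
`IsAdm`; `W_eq_adm` identifies it with the span of `Ghat`. -/
def adm : Submodule ℂ Bivec where
  carrier := {b | IsAdm fun i j => pl i j b}
  zero_mem' := by simp [IsAdm]
  add_mem' := by
    rintro a b ⟨h1, h2, h3, h4, h5, h6, h7⟩ ⟨k1, k2, k3, k4, k5, k6, k7⟩
    simp only [IsAdm, Set.mem_ofPred_eq, map_add]
    refine ⟨?_, ?_, ?_, ?_, ?_, ?_, ?_⟩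
    · linear_combination h1 + k1
    · linear_combination h2 + k2
    · linear_combination h3 + k3
    · linear_combination h4 + k4
    · linear_combination h5 + k5
    · linear_combination h6 + k6
    · linear_combination h7 + k7
  smul_mem' := by
    rintro c b ⟨h1, h2, h3, h4, h5, h6, h7⟩
    simp only [IsAdm, Set.mem_ofPred_eq, map_smul, smul_eq_mul]
    refine ⟨?_, ?_, ?_, ?_, ?_, ?_, ?_⟩
    · linear_combination c * h1
    · linear_combination c * h2
    · linear_combination c * h3
    · linear_combination c * h4
    · linear_combination c * h5
    · linear_combination c * h6
    · linear_combination c * h7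

lemma mem_adm {b : Bivec} : b ∈ adm ↔ IsAdm fun i j => pl i j b := Iff.rfl

/-- The affine cone over `Ghat`. -/
def IsCone (b : Bivec) : Prop := ∃ v w : V, b = wedgeB v w ∧ IsAdm (minor v w)

lemma isCone_iff (b : Bivec) :
    (∃ v w : V, b.toExt = wedge v w ∧ wedge v w * omega0 = 0) ↔ IsCone b := by
  simp only [IsCone, wedge_mul_omega0_eq_zero_iff]
  simp only [← toExt_wedgeB, Bivec.toExt_injective.eq_iff]

lemma isCone_wedgeB {v w : V} (h : IsAdm (minor v w)) : IsCone (wedgeB v w) := ⟨v, w, rfl, h⟩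

lemma wedgeB_mem_adm_iff {v w : V} : wedgeB v w ∈ adm ↔ IsAdm (minor v w) := by
  have h : (fun i j => pl i j (wedgeB v w)) = minor v w := funext₂ fun i j => pl_wedgeB i j v w
  rw [mem_adm, h]

lemma IsCone.mem_adm {b : Bivec} (h : IsCone b) : b ∈ adm := by
  obtain ⟨v, w, rfl, h⟩ := h
  exact wedgeB_mem_adm_iff.2 h

lemma IsCone.smul {b : Bivec} (h : IsCone b) (c : ℂ) : IsCone (c • b) := by
  have h' := adm.smul_mem c h.mem_adm
  obtain ⟨v, w, rfl, -⟩ := h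
  rw [← map_smul] at h' ⊢
  exact isCone_wedgeB (wedgeB_mem_adm_iff.1 h')

lemma isCone_smul_iff {b : Bivec} {c : ℂ} (hc : c ≠ 0) : IsCone (c • b) ↔ IsCone b :=
  ⟨fun h => by simpa [smul_smul, hc] using h.smul c⁻¹, fun h => h.smul c⟩

/-- The Plücker relations hold on decomposable bivectors. -/
lemma IsCone.plucker {b : Bivec} (h : IsCone b) (i j k l : Fin 7) :
    pl i j b * pl k l b - pl i k b * pl j l b + pl i l b * pl j k b = 0 := by
  obtain ⟨v, w, rfl, -⟩ := h
  simp only [pl_wedgeB]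
  ring

lemma isCone_of_plucker {b : Bivec} (hb : b ∈ adm)
    (h : ∀ i j k l, pl i j b * pl k l b - pl i k b * pl j l b + pl i l b * pl j k b = 0) :
    IsCone b := by
  by_cases h0 : ∃ i j, pl i j b ≠ 0
  · -- two rows of the coordinate matrix through a non-zero entry span the plane of `b`
    obtain ⟨i, j, hij⟩ := h0
    have hbw : b = wedgeB ((pl i j b)⁻¹ • fun k => pl i k b) fun k => pl j k b := by
      refine pl_ext fun k l => ?_
      simp only [pl_wedgeB, Pi.smul_apply, smul_eq_mul]
      field_simp
      linear_combination h i j k l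
    refine ⟨_, _, hbw, ?_⟩
    rw [hbw] at hb
    exact wedgeB_mem_adm_iff.1 hb
  · push Not at h0
    refine ⟨0, 0, pl_ext fun i j => by simp [h0], ?_⟩
    simp [IsAdm, minor]

/-- A bivector satisfying the seven linear equations vanishes once fourteen of its coordinates
do. -/
lemma eq_zero_of_mem_adm {b : Bivec} (hb : b ∈ adm) (h02 : pl 0 2 b = 0) (h03 : pl 0 3 b = 0)
    (h04 : pl 0 4 b = 0) (h05 : pl 0 5 b = 0) (h06 : pl 0 6 b = 0) (h24 : pl 2 4 b = 0)
    (h12 : pl 1 2 b = 0) (h13 : pl 1 3 b = 0) (h15 : pl 1 5 b = 0) (h16 : pl 1 6 b = 0)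
    (h23 : pl 2 3 b = 0) (h25 : pl 2 5 b = 0) (h26 : pl 2 6 b = 0) (h56 : pl 5 6 b = 0) :
    b = 0 := by
  obtain ⟨k1, k2, k3, k4, k5, k6, k7⟩ := hb
  simp only [h02, h03, h06, h12, h16, zero_add, zero_sub, sub_zero, add_zero, neg_eq_zero]
    at k3 k4 k5 k6 k7
  have hlt : ∀ i j : Fin 7, i < j → pl i j b = 0 := by
    intro i j hij
    fin_cases i <;> fin_cases j <;> first | (exfalso; revert hij; decide) | assumption
  refine pl_ext fun i j => ?_
  rw [map_zero]
  rcases lt_trichotomy i j with hij | rfl | hij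
  · exact hlt i j hij
  · exact pl_self i b
  · rw [pl_swap, hlt j i hij, neg_zero]

lemma eq_of_mem_adm {b b' : Bivec} (hb : b ∈ adm) (hb' : b' ∈ adm) (h02 : pl 0 2 b = pl 0 2 b')
    (h03 : pl 0 3 b = pl 0 3 b') (h04 : pl 0 4 b = pl 0 4 b') (h05 : pl 0 5 b = pl 0 5 b')
    (h06 : pl 0 6 b = pl 0 6 b') (h24 : pl 2 4 b = pl 2 4 b') (h12 : pl 1 2 b = pl 1 2 b')
    (h13 : pl 1 3 b = pl 1 3 b') (h15 : pl 1 5 b = pl 1 5 b') (h16 : pl 1 6 b = pl 1 6 b')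
    (h23 : pl 2 3 b = pl 2 3 b') (h25 : pl 2 5 b = pl 2 5 b') (h26 : pl 2 6 b = pl 2 6 b')
    (h56 : pl 5 6 b = pl 5 6 b') : b = b' := by
  rw [← sub_eq_zero]
  apply eq_zero_of_mem_adm (adm.sub_mem hb hb') <;> rw [map_sub, sub_eq_zero] <;> assumption

/-- The first vector of a point of `Ghat` parametrized by `y`; see `phi0`. -/
def rowV : (Fin 6 → ℂ) →ₗ[ℂ] V where
  toFun y := ![y 2, -y 1, y 5, 0, 0, y 4, -y 0]
  map_add' y z := by
    ext i; fin_cases i <;> simp [add_comm]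
  map_smul' c y := by
    ext i; fin_cases i <;> simp

/-- The second vector of a point of `Ghat` parametrized by `y`; see `phi0`. -/
def rowW : (Fin 6 → ℂ) →ₗ[ℂ] V where
  toFun y := ![0, 0, y 0, y 1, y 2, y 3, y 4]
  map_add' y z := by
    ext i; fin_cases i <;> simp
  map_smul' c y := by
    ext i; fin_cases i <;> simp

lemma rowV_apply (y : Fin 6 → ℂ) : rowV y = ![y 2, -y 1, y 5, 0, 0, y 4, -y 0] := rfl

lemma rowW_apply (y : Fin 6 → ℂ) : rowW y = ![0, 0, y 0, y 1, y 2, y 3, y 4] := rfl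

/-- The rational parametrization of `Ghat` by `ℙ⁵`: where `y 2 = 1`, the plane is spanned by two
vectors in echelon form with respect to the coordinates `x₁, x₅`. -/
def phi0 (y : Fin 6 → ℂ) : Bivec := wedgeB (rowV y) (rowW y)

/-- The coordinates `p₁₃, p₁₄, p₁₅, p₁₆, p₁₇, p₃₅`, which are linear equations of the span of `F`
in the span of `Ghat`. -/
def pi0 : Bivec →ₗ[ℂ] (Fin 6 → ℂ) :=
  LinearMap.pi ![pl 0 2, pl 0 3, pl 0 4, pl 0 5, pl 0 6, pl 2 4]

lemma pi0_apply (b : Bivec) :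
    pi0 b = ![pl 0 2 b, pl 0 3 b, pl 0 4 b, pl 0 5 b, pl 0 6 b, pl 2 4 b] := by
  ext i; fin_cases i <;> rfl

lemma isCone_phi0 (y : Fin 6 → ℂ) : IsCone (phi0 y) := by
  refine isCone_wedgeB ?_
  simp only [IsAdm, minor, rowV_apply, rowW_apply]
  refine ⟨?_, ?_, ?_, ?_, ?_, ?_, ?_⟩ <;> simp <;> ring

lemma pi0_phi0 (y : Fin 6 → ℂ) : pi0 (phi0 y) = y 2 • y := by
  rw [pi0_apply]
  ext i
  fin_cases i <;> simp [phi0, rowV_apply, rowW_apply, mul_comm]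

/-- On the cone, `phi0` inverts `pi0` up to the factor `p₁₅`: the vectors `rowV`, `rowW` become
the rows of the coordinate matrix through the entry `p₁₅`, and the Plücker relations apply. -/
lemma IsCone.phi0_pi0 {b : Bivec} (h : IsCone b) : phi0 (pi0 b) = pl 0 4 b • b := by
  have hp := h.plucker
  obtain ⟨k1, k2, k3, k4, k5, k6, k7⟩ := h.mem_adm
  have hs : ∀ i j, pl i j b = -pl j i b := fun i j => pl_swap i j b
  have hv : rowV (pi0 b) = fun k => pl k 4 b := by
    ext k
    fin_cases k <;> simp [rowV_apply, pi0_apply]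
    · linear_combination -k7
    · exact k2.symm
    · exact (pl_self 4 b).symm
    · linear_combination k5 - hs 5 4
    · linear_combination -k4 - hs 6 4
  have hw : rowW (pi0 b) = fun k => pl 0 k b := by
    ext k
    fin_cases k <;> simp [rowW_apply, pi0_apply]
    · exact (pl_self 0 b).symm
    · exact k1.symm
  rw [phi0, hv, hw]
  refine pl_ext fun k l => ?_
  rw [pl_wedgeB, map_smul, smul_eq_mul]
  linear_combination -hp 0 4 k l + pl 0 l b * hs k 4 - pl 0 k b * hs l 4

/-- The kernel of `pi0` in `adm` is spanned by the vectors `phi0 y` with `y 2 = 0`. -/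
lemma mem_of_pi0_eq_zero {N : Submodule ℂ Bivec} (hN : ∀ y, y 2 = 0 → phi0 y ∈ N) {b : Bivec}
    (hb : b ∈ adm) (h0 : pi0 b = 0) : b ∈ N := by
  have key : b = (-pl 1 2 b) • phi0 ![1, 1, 0, 0, 0, 0] + (-pl 1 5 b) • phi0 ![0, 1, 0, 1, 0, 0] +
      (-pl 1 6 b) • phi0 ![0, 1, 0, 0, 1, 0] + pl 2 3 b • phi0 ![0, 1, 0, 0, 0, 1] +
      pl 2 5 b • phi0 ![0, 0, 0, 1, 0, 1] + (pl 2 6 b + pl 1 2 b) • phi0 ![1, 0, 0, 0, 0, 0] +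
      (pl 5 6 b + pl 1 6 b) • phi0 ![0, 0, 0, 0, 1, 0] +
      (pl 1 2 b + pl 1 5 b + pl 1 6 b - pl 2 3 b - pl 1 3 b) • phi0 ![0, 1, 0, 0, 0, 0] := by
    have h : ∀ i, pi0 b i = 0 := fun i => congrFun h0 i
    simp only [pi0_apply] at h
    have a0 : pl 0 2 b = 0 := h 0
    have a1 : pl 0 3 b = 0 := h 1
    have a2 : pl 0 4 b = 0 := h 2
    have a3 : pl 0 5 b = 0 := h 3
    have a4 : pl 0 6 b = 0 := h 4
    have a5 : pl 2 4 b = 0 := h 5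
    refine eq_of_mem_adm hb ?_ ?_ ?_ ?_ ?_ ?_ ?_ ?_ ?_ ?_ ?_ ?_ ?_ ?_ ?_
    · have hc : ∀ (c : ℂ) y, c • phi0 y ∈ adm := fun c y => ((isCone_phi0 y).smul c).mem_adm
      exact adm.add_mem (adm.add_mem (adm.add_mem (adm.add_mem (adm.add_mem (adm.add_mem
        (adm.add_mem (hc _ _) (hc _ _)) (hc _ _)) (hc _ _)) (hc _ _)) (hc _ _)) (hc _ _)) (hc _ _)
    all_goals simp [phi0, rowV_apply, rowW_apply, a0, a1, a2, a3, a4, a5]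
    ring
  have hc : ∀ (c : ℂ) y, y 2 = 0 → c • phi0 y ∈ N := fun c y hy => N.smul_mem c (hN y hy)
  rw [key]
  refine N.add_mem (N.add_mem (N.add_mem (N.add_mem (N.add_mem (N.add_mem (N.add_mem
    ?_ ?_) ?_) ?_) ?_) ?_) ?_) ?_ <;> exact hc _ _ rfl

/-- A vector of `adm` differs from a combination of two vectors `phi0 y` by an element of the
kernel of `pi0`, so that `adm` is spanned by the image of `phi0`. -/
lemma adm_le {N : Submodule ℂ Bivec} (hN : ∀ y, phi0 y ∈ N) : adm ≤ N := by
  intro b hb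
  let y : Fin 6 → ℂ := Function.update (pi0 b) 2 1
  let b' : Bivec := phi0 y + (pi0 b 2 - 1) • phi0 (Pi.single 2 1)
  have hb' : b' ∈ N := N.add_mem (hN _) (N.smul_mem _ (hN _))
  have hadm : b' ∈ adm :=
    adm.add_mem (isCone_phi0 _).mem_adm ((isCone_phi0 _).smul _).mem_adm
  have h0 : pi0 (b - b') = 0 := by
    ext i
    by_cases hi : i = 2
    · subst hi
      simp [b', pi0_phi0, y]
    · simp [b', pi0_phi0, y, hi]
  have := mem_of_pi0_eq_zero (N := N) (fun y _ => hN y) (adm.sub_mem hb hadm) h0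
  simpa using N.add_mem this hb'

end Cone

/-! ### Density of the points with `p₁₅ ≠ 0` -/

section Closure

open Filter

lemma mk_mem_Ghat_iff {b : Bivec} (hb : b ≠ 0) : Projectivization.mk ℂ b hb ∈ Ghat ↔ IsCone b := by
  obtain ⟨a, ha⟩ := Projectivization.exists_smul_eq_mk_rep ℂ b hb
  change (∃ v w : V, _ ∧ _) ↔ _
  rw [isCone_iff, ← ha, Units.smul_def, isCone_smul_iff a.ne_zero]

lemma IsCone.mem_W {b : Bivec} (h : IsCone b) : b ∈ W :=
  mem_linSpan fun hb => (mk_mem_Ghat_iff hb).2 h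

lemma W_eq_adm : W = adm :=
  le_antisymm (linSpan_le fun _ hp => ((isCone_iff _).1 hp).mem_adm)
    (adm_le fun y => (isCone_phi0 y).mem_W)

lemma mk_mem_GhatW_iff {b : W} (hb : b ≠ 0) :
    Projectivization.mk ℂ b hb ∈ GhatW ↔ IsCone (b : Bivec) := by
  change Projectivization.map W.subtype W.injective_subtype (Projectivization.mk ℂ b hb) ∈ Ghat ↔ _
  rw [Projectivization.map_mk, mk_mem_Ghat_iff]
  rfl

lemma mem_GhatW_iff {p : ℙ ℂ W} : p ∈ GhatW ↔ IsCone (p.rep : Bivec) := by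
  conv_lhs => rw [← p.mk_rep]
  exact mk_mem_GhatW_iff _

lemma mem_linSpan_F_iff {b : Bivec} : b ∈ linSpan F ↔ b ∈ adm ∧ pi0 b = 0 := by
  constructor
  · have h : linSpan F ≤ adm ⊓ LinearMap.ker pi0 := by
      refine linSpan_le ?_
      rintro p ⟨v, w, ⟨hv0, hv4⟩, ⟨hw0, hw4⟩, hvw, h⟩
      refine ⟨((isCone_iff _).1 ⟨v, w, hvw, h⟩).mem_adm, ?_⟩
      change pi0 _ = 0
      rw [pi0_apply]
      simp only [pl_of_toExt_eq hvw, minor]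
      ext i
      fin_cases i <;> simp [hv0, hv4, hw0, hw4]
    exact fun hb => h hb
  · rintro ⟨hb, h0⟩
    refine mem_of_pi0_eq_zero (fun y hy => mem_linSpan fun hne => ?_) hb h0
    obtain ⟨a, ha⟩ := Projectivization.exists_smul_eq_mk_rep ℂ _ hne
    refine ⟨(a : ℂ) • rowV y, rowW y, ?_, ?_, ?_, ?_⟩
    · simp [rowV_apply, hy]
    · simp [rowW_apply, hy]
    · rw [← ha, phi0, Units.smul_def, ← toExt_wedgeB, map_smul wedgeB, LinearMap.smul_apply]
    · have h := (isCone_phi0 y).smul (a : ℂ)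
      rw [phi0, ← LinearMap.smul_apply, ← map_smul wedgeB] at h
      rw [wedge_mul_omega0_eq_zero_iff]
      exact wedgeB_mem_adm_iff.1 h.mem_adm

lemma isClosed_GhatW : @IsClosed _ (zariski W) GhatW := by
  let _ := zariski W
  let l (i j : Fin 7) : Module.Dual ℂ W := pl i j ∘ₗ W.subtype
  let f (i j k m : Fin 7) : W → ℂ := (l i j : W → ℂ) * l k m - l i k * l j m + l i m * l j k
  have hf : ∀ i j k m, IsForm 2 (f i j k m) := fun i j k m =>
    ⟨(polyFun W).add_mem ((polyFun W).sub_mem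
      ((polyFun W).mul_mem (dual_mem_polyFun _) (dual_mem_polyFun _))
      ((polyFun W).mul_mem (dual_mem_polyFun _) (dual_mem_polyFun _)))
      ((polyFun W).mul_mem (dual_mem_polyFun _) (dual_mem_polyFun _)), fun c x => by
        simp only [f, Pi.add_apply, Pi.sub_apply, Pi.mul_apply, map_smul, smul_eq_mul]
        ring⟩
  have h : GhatW = ⋂ i, ⋂ j, ⋂ k, ⋂ m, {p : ℙ ℂ W | f i j k m p.rep = 0} := by
    ext p
    simp only [Set.mem_iInter]
    rw [mem_GhatW_iff]
    exact ⟨fun h i j k m => h.plucker i j k m,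
      fun h => isCone_of_plucker (W_eq_adm ▸ p.rep.2) h⟩
  rw [h]
  exact isClosed_iInter fun i => isClosed_iInter fun j => isClosed_iInter fun k =>
    isClosed_iInter fun m => (hf i j k m).isClosed

/-- The bivector `b` is zero, or lies outside of the span of `Ghat`, or represents a point
of `Z`. -/
def Represents (Z : Set (ℙ ℂ W)) (b : Bivec) : Prop :=
  ∀ (hb : b ∈ W) (h : (⟨b, hb⟩ : W) ≠ 0), Projectivization.mk ℂ _ h ∈ Z

lemma Represents.neg {Z : Set (ℙ ℂ W)} {b : Bivec} (h : Represents Z b) : Represents Z (-b) := by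
  intro hb h0
  have hb' : b ∈ W := by simpa using W.neg_mem hb
  have h0' : (⟨b, hb'⟩ : W) ≠ 0 := fun h => h0 (by
    rw [Subtype.ext_iff] at h ⊢
    simpa using h)
  have he : Projectivization.mk ℂ _ h0 = Projectivization.mk ℂ _ h0' := by
    rw [Projectivization.mk_eq_mk_iff']
    exact ⟨-1, Subtype.ext (by simp)⟩
  rw [he]
  exact h hb' h0'

lemma Represents.swap {Z : Set (ℙ ℂ W)} {v w : V} (h : Represents Z (wedgeB v w)) :
    Represents Z (wedgeB w v) := by
  rw [wedgeB_swap]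
  exact h.neg

/-- If the planes `⟨v + t v', w + t w'⟩` lie in `Ghat` for all `t` and represent points of the
closed set `Z` for almost all `t`, then so does the plane at `t = 0`. -/
lemma represents_of_curve {Z : Set (ℙ ℂ W)} (hZ : @IsClosed _ (zariski W) Z) {v v' w w' : V}
    (hc : ∀ t : ℂ, IsAdm (minor (v + t • v') (w + t • w')))
    (h : ∀ᶠ t : ℂ in cofinite, Represents Z (wedgeB (v + t • v') (w + t • w'))) :
    Represents Z (wedgeB v w) := by
  intro hb h0
  let γ : ℂ → W := fun t => ⟨_, (isCone_wedgeB (hc t)).mem_W⟩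
  have hγ : IsPolyCurve γ := by
    intro l
    obtain ⟨l', hl'⟩ := LinearMap.exists_extend l
    refine ⟨Polynomial.C (l' (wedgeB v w)) +
      Polynomial.C (l' (wedgeB v' w) + l' (wedgeB v w')) * Polynomial.X +
      Polynomial.C (l' (wedgeB v' w')) * Polynomial.X ^ 2, fun t => ?_⟩
    have : l (γ t) = l' (wedgeB (v + t • v') (w + t • w')) := by
      rw [← hl']; rfl
    rw [this]
    simp
    ring
  have h00 : γ 0 = ⟨_, hb⟩ := Subtype.ext (by simp [γ])
  have h0' : γ 0 ≠ 0 := by rwa [h00]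
  have key := mk_mem_of_isPolyCurve hZ hγ (h.mono fun t ht hne => ht _ hne) h0'
  convert key using 2
  exact h00.symm

lemma eventually_quadratic_ne_zero {a b c : ℂ} (h : a ≠ 0 ∨ b ≠ 0 ∨ c ≠ 0) :
    ∀ᶠ t : ℂ in cofinite, a + b * t + c * t ^ 2 ≠ 0 := by
  let P : Polynomial ℂ := Polynomial.C a + Polynomial.C b * Polynomial.X +
    Polynomial.C c * Polynomial.X ^ 2
  have hP : P ≠ 0 := by
    intro h0
    have h1 := congrArg (Polynomial.coeff · 0) h0
    have h2 := congrArg (Polynomial.coeff · 1) h0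
    have h3 := congrArg (Polynomial.coeff · 2) h0
    simp [P, Polynomial.coeff_X, Polynomial.coeff_C] at h1 h2 h3
    simp [h1, h2, h3] at h
  rw [eventually_cofinite]
  refine (P.roots.toFinset.finite_toSet).subset fun t ht => ?_
  have ht' : P.eval t = 0 := by simpa [P] using ht
  simpa [hP] using ht'

/-- The one-parameter group `x₂ ↦ x₂ + t x₁`, `x₄ ↦ x₄ - t x₅` preserves `Ghat` and moves a plane
with one of the coordinates `p₁₄, p₁₅, p₂₄` non-zero to one with `p₁₅ ≠ 0`. -/
lemma represents_of_minor_ne_zero {Z : Set (ℙ ℂ W)} (hZ : @IsClosed _ (zariski W) Z)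
    (h : ∀ b, IsCone b → pl 0 4 b ≠ 0 → Represents Z b) {v w : V} (hvw : IsAdm (minor v w))
    (hne : minor v w 0 4 ≠ 0 ∨ minor v w 0 3 ≠ 0 ∨ minor v w 1 3 ≠ 0) :
    Represents Z (wedgeB v w) := by
  obtain ⟨k1, k2, k3, k4, k5, k6, k7⟩ := hvw
  simp only [minor] at k1 k2 k3 k4 k5 k6 k7 hne
  have hc : ∀ t : ℂ, IsAdm (minor (v + t • ![v 1, 0, 0, 0, -v 3, 0, 0])
      (w + t • ![w 1, 0, 0, 0, -w 3, 0, 0])) := by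
    intro t
    simp only [IsAdm, minor, Pi.add_apply, Pi.smul_apply, smul_eq_mul]
    refine ⟨?_, ?_, ?_, ?_, ?_, ?_, ?_⟩ <;> simp
    · linear_combination k1
    · linear_combination k2
    · linear_combination k3
    · linear_combination k4 + t * k3
    · linear_combination k5 - t * k6
    · linear_combination k6
    · linear_combination k7
  refine represents_of_curve hZ hc ?_
  have hev := eventually_quadratic_ne_zero (a := v 0 * w 4 - v 4 * w 0)
    (b := -2 * (v 0 * w 3 - v 3 * w 0)) (c := -(v 1 * w 3 - v 3 * w 1))
    (by simpa only [ne_eq, neg_eq_zero, mul_eq_zero, OfNat.ofNat_ne_zero, false_or] using hne)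
  filter_upwards [hev] with t ht
  refine h _ (isCone_wedgeB (hc t)) ?_
  convert ht using 1
  simp only [pl_wedgeB, Pi.add_apply, Pi.smul_apply, smul_eq_mul]
  simp
  linear_combination t * k7

/-- A plane containing a vector `v` with non-zero `x₁, x₂, x₄, x₅`-part of the special form given
by the relation `h` can be moved in `Ghat`, with `v` fixed, in a direction in which
`p₁₅` or `p₂₄` is non-zero. -/
lemma exists_direction {v : V} (h : v 0 * v 3 + v 1 * v 4 = 0)
    (hne : v 1 ≠ 0 ∨ v 3 ≠ 0 ∨ v 0 ≠ 0 ∨ v 4 ≠ 0) :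
    ∃ w : V, IsAdm (minor v w) ∧ (minor v w 0 4 ≠ 0 ∨ minor v w 1 3 ≠ 0) := by
  rcases hne with hv | hv | hv | hv
  · refine ⟨![0, 0, v 1 * v 6 + v 3 * v 5, v 1 ^ 2, -(v 0 * v 1), 0, -(v 1 * v 5)], ?_, Or.inr ?_⟩
    · simp only [IsAdm, minor]
      refine ⟨?_, ?_, ?_, ?_, ?_, ?_, ?_⟩ <;> simp
      all_goals first | ring1 | linear_combination (-v 1) * h | linear_combination (v 5) * h
    · simp [minor, hv]
  · refine ⟨![-(v 3 * v 4), v 3 ^ 2, 0, 0, 0, v 1 * v 2 - v 3 * v 6, v 2 * v 3], ?_, Or.inr ?_⟩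
    · simp only [IsAdm, minor]
      refine ⟨?_, ?_, ?_, ?_, ?_, ?_, ?_⟩ <;> simp
      all_goals first | ring1 | linear_combination (v 3) * h | linear_combination (v 2) * h
    · simp [minor, hv]
  · refine ⟨![0, 0, v 0 * v 6 - v 4 * v 5, v 0 * v 1, -v 0 ^ 2, 0, -(v 0 * v 5)], ?_, Or.inl ?_⟩
    · simp only [IsAdm, minor]
      refine ⟨?_, ?_, ?_, ?_, ?_, ?_, ?_⟩ <;> simp
      all_goals first | ring1 | linear_combination (-v 0) * h | linear_combination (-v 5) * h
    · simp [minor, hv]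
  · refine ⟨![v 4 ^ 2, -(v 3 * v 4), 0, 0, 0, v 4 * v 6 + v 0 * v 2, -(v 2 * v 4)], ?_, Or.inl ?_⟩
    · simp only [IsAdm, minor]
      refine ⟨?_, ?_, ?_, ?_, ?_, ?_, ?_⟩ <;> simp
      all_goals first | ring1 | linear_combination (-v 4) * h | linear_combination (v 2) * h
    · simp [minor, hv]

/-- The planes `⟨v, w⟩` with `w` in `⟨x₃, x₆, x₇⟩` and `v` not in this space. -/
lemma represents_of_right_mem {Z : Set (ℙ ℂ W)} (hZ : @IsClosed _ (zariski W) Z)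
    (h : ∀ b, IsCone b → pl 0 4 b ≠ 0 → Represents Z b) {v w : V} (hvw : IsAdm (minor v w))
    (hv : v 1 ≠ 0 ∨ v 3 ≠ 0 ∨ v 0 ≠ 0 ∨ v 4 ≠ 0)
    (hw0 : w 0 = 0) (hw1 : w 1 = 0) (hw3 : w 3 = 0) (hw4 : w 4 = 0) :
    Represents Z (wedgeB v w) := by
  by_cases hw : w = 0
  · intro _ h0
    exact absurd (Subtype.ext (by simp [hw])) h0
  have k := hvw
  obtain ⟨-, -, k3, k4, k5, k6, -⟩ := k
  simp only [minor, hw0, hw1, hw3, hw4, mul_zero, sub_zero] at k3 k4 k5 k6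
  have hrel : v 0 * v 3 + v 1 * v 4 = 0 := by
    by_contra hne
    have e2 : w 2 = 0 := by
      refine (mul_eq_zero.1 ?_).resolve_left hne
      linear_combination v 3 * k4 + v 4 * k3
    have e5 : w 5 = 0 := by
      refine (mul_eq_zero.1 ?_).resolve_left hne
      linear_combination v 0 * k6 + v 1 * k5
    have e6 : w 6 = 0 := by
      refine (mul_eq_zero.1 ?_).resolve_left hne
      linear_combination v 0 * k3 - v 1 * k4
    exact hw (by ext i; fin_cases i <;> simp [hw0, hw1, hw3, hw4, e2, e5, e6])
  obtain ⟨w', hw', hne⟩ := exists_direction hrel hv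
  have hc : ∀ t : ℂ, IsAdm (minor (v + t • 0) (w + t • w')) := by
    intro t
    rw [← wedgeB_mem_adm_iff, smul_zero, add_zero, map_add, map_smul]
    exact adm.add_mem (wedgeB_mem_adm_iff.2 hvw) (adm.smul_mem _ (wedgeB_mem_adm_iff.2 hw'))
  refine represents_of_curve hZ hc ?_
  filter_upwards [(Set.finite_singleton (0 : ℂ)).compl_mem_cofinite] with t ht
  have ht0 : t ≠ 0 := ht
  refine represents_of_minor_ne_zero hZ h (hc t) ?_
  have e : ∀ i j, w i = 0 → w j = 0 →
      minor (v + t • 0) (w + t • w') i j = t * minor v w' i j := fun i j hi hj => by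
    simp [minor, hi, hj]
    ring
  rw [e 0 4 hw0 hw4, e 0 3 hw0 hw3, e 1 3 hw1 hw3]
  rcases hne with hne | hne
  · exact Or.inl (mul_ne_zero ht0 hne)
  · exact Or.inr (Or.inr (mul_ne_zero ht0 hne))

/-- The planes in `⟨x₃, x₆, x₇⟩` spanned by `v` and a vector `w` on the conic of degenerate
vectors. -/
lemma represents_of_conic {Z : Set (ℙ ℂ W)} (hZ : @IsClosed _ (zariski W) Z)
    (h : ∀ b, IsCone b → pl 0 4 b ≠ 0 → Represents Z b) {v w : V}
    (hv0 : v 0 = 0) (hv1 : v 1 = 0) (hv3 : v 3 = 0) (hv4 : v 4 = 0)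
    (hw0 : w 0 = 0) (hw1 : w 1 = 0) (hw3 : w 3 = 0) (hw4 : w 4 = 0)
    (hq : w 2 * w 5 + w 6 ^ 2 = 0) : Represents Z (wedgeB v w) := by
  by_cases hw : w = 0
  · intro _ h0
    exact absurd (Subtype.ext (by simp [hw])) h0
  -- a non-zero solution of `a * w 2 + b * w 6 = 0` and `b * w 5 = a * w 6`
  obtain ⟨a, b, hab, k1, k2⟩ : ∃ a b : ℂ, (a ≠ 0 ∨ b ≠ 0) ∧ a * w 2 + b * w 6 = 0 ∧
      b * w 5 - a * w 6 = 0 := by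
    by_cases h6 : w 6 = 0 ∧ w 2 = 0
    · refine ⟨w 5, w 6, ?_, by simp [h6.1, h6.2], by ring⟩
      by_contra! h5
      exact hw (by ext i; fin_cases i <;> simp [hw0, hw1, hw3, hw4, h5, h6.2])
    · refine ⟨-w 6, w 2, ?_, by ring, by linear_combination hq⟩
      rw [neg_ne_zero]
      exact not_and_or.1 h6
  have hc : ∀ t : ℂ, IsAdm (minor (v + t • ![0, a, 0, b, 0, 0, 0]) (w + t • 0)) := by
    intro t
    simp only [IsAdm, minor, Pi.add_apply, Pi.smul_apply, smul_eq_mul, hv0, hv1, hv3, hv4, hw0,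
      hw1, hw3, hw4]
    refine ⟨?_, ?_, ?_, ?_, ?_, ?_, ?_⟩ <;> simp
    · linear_combination t * k1
    · linear_combination t * k2
  refine represents_of_curve hZ hc ?_
  filter_upwards [(Set.finite_singleton (0 : ℂ)).compl_mem_cofinite] with t ht
  have ht0 : t ≠ 0 := ht
  refine represents_of_right_mem hZ h (hc t) ?_ ?_ ?_ ?_ ?_
  · rcases hab with ha | hb
    · exact Or.inl (by simp [hv1, ht0, ha])
    · exact Or.inr (Or.inl (by simp [hv3, ht0, hb]))
  all_goals simp [hw0, hw1, hw3, hw4]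

lemma wedgeB_sub_smul_right (v w : V) (c : ℂ) : wedgeB v (w - c • v) = wedgeB v w := by
  rw [map_sub, map_smul, wedgeB_self, smul_zero, sub_zero]

/-- The planes contained in `⟨x₃, x₆, x₇⟩`: each of them meets the conic of degenerate
vectors. -/
lemma represents_of_mem {Z : Set (ℙ ℂ W)} (hZ : @IsClosed _ (zariski W) Z)
    (h : ∀ b, IsCone b → pl 0 4 b ≠ 0 → Represents Z b) {v w : V}
    (hv0 : v 0 = 0) (hv1 : v 1 = 0) (hv3 : v 3 = 0) (hv4 : v 4 = 0)
    (hw0 : w 0 = 0) (hw1 : w 1 = 0) (hw3 : w 3 = 0) (hw4 : w 4 = 0) :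
    Represents Z (wedgeB v w) := by
  by_cases hq : v 2 * v 5 + v 6 ^ 2 = 0
  · exact (represents_of_conic hZ h hw0 hw1 hw3 hw4 hv0 hv1 hv3 hv4 hq).swap
  obtain ⟨s, hs⟩ := IsAlgClosed.exists_eq_mul_self
    (discrim (v 2 * v 5 + v 6 ^ 2) (-(v 2 * w 5 + v 5 * w 2 + 2 * v 6 * w 6))
      (w 2 * w 5 + w 6 ^ 2))
  obtain ⟨c, hc⟩ := exists_quadratic_eq_zero hq ⟨s, hs⟩
  rw [← wedgeB_sub_smul_right v w c]
  apply represents_of_conic hZ h hv0 hv1 hv3 hv4 <;> simp [hv0, hv1, hv3, hv4, hw0, hw1, hw3, hw4]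
  linear_combination hc

/-- The planes `⟨v, w⟩` with `v` not in `⟨x₃, x₆, x₇⟩`. -/
lemma represents_of_left_ne_zero {Z : Set (ℙ ℂ W)} (hZ : @IsClosed _ (zariski W) Z)
    (h : ∀ b, IsCone b → pl 0 4 b ≠ 0 → Represents Z b) {v w : V} (hvw : IsAdm (minor v w))
    (hv : v 1 ≠ 0 ∨ v 3 ≠ 0 ∨ v 0 ≠ 0 ∨ v 4 ≠ 0) : Represents Z (wedgeB v w) := by
  by_cases hne : minor v w 0 4 ≠ 0 ∨ minor v w 0 3 ≠ 0 ∨ minor v w 1 3 ≠ 0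
  · exact represents_of_minor_ne_zero hZ h hvw hne
  push Not at hne
  obtain ⟨m04, m03, m13⟩ := hne
  have k := hvw
  obtain ⟨m01, m34, -, -, -, -, m14⟩ := k
  rw [m03, zero_add] at m14
  -- all minors of the `x₁, x₂, x₄, x₅`-part vanish, so that a multiple of `v` can be
  -- subtracted from `w` to make this part of `w` zero
  simp only [minor] at m01 m03 m04 m13 m14 m34
  obtain ⟨c, c0, c1, c3, c4⟩ : ∃ c : ℂ, w 0 - c * v 0 = 0 ∧ w 1 - c * v 1 = 0 ∧
      w 3 - c * v 3 = 0 ∧ w 4 - c * v 4 = 0 := by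
    rcases hv with hv | hv | hv | hv
    · refine ⟨w 1 / v 1, ?_, ?_, ?_, ?_⟩ <;> field_simp
      · linear_combination -m01
      · simp
      · linear_combination m13
      · linear_combination m14
    · refine ⟨w 3 / v 3, ?_, ?_, ?_, ?_⟩ <;> field_simp
      · linear_combination -m03
      · linear_combination -m13
      · simp
      · linear_combination m34
    · refine ⟨w 0 / v 0, ?_, ?_, ?_, ?_⟩ <;> field_simp
      · simp
      · linear_combination m01
      · linear_combination m03
      · linear_combination m04
    · refine ⟨w 4 / v 4, ?_, ?_, ?_, ?_⟩ <;> field_simp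
      · linear_combination -m04
      · linear_combination -m14
      · linear_combination -m34
      · simp
  have hvw' := wedgeB_mem_adm_iff.2 hvw
  rw [← wedgeB_sub_smul_right v w c] at hvw' ⊢
  exact represents_of_right_mem hZ h (wedgeB_mem_adm_iff.1 hvw') hv c0 c1 c3 c4

/-- `Ghat` is contained in the closure of its points with `p₁₅ ≠ 0`. -/
lemma represents_of_isCone {Z : Set (ℙ ℂ W)} (hZ : @IsClosed _ (zariski W) Z)
    (h : ∀ b, IsCone b → pl 0 4 b ≠ 0 → Represents Z b) {b : Bivec} (hb : IsCone b) :
    Represents Z b := by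
  obtain ⟨v, w, rfl, hvw⟩ := hb
  by_cases hv : v 1 ≠ 0 ∨ v 3 ≠ 0 ∨ v 0 ≠ 0 ∨ v 4 ≠ 0
  · exact represents_of_left_ne_zero hZ h hvw hv
  by_cases hw : w 1 ≠ 0 ∨ w 3 ≠ 0 ∨ w 0 ≠ 0 ∨ w 4 ≠ 0
  · have hwv := adm.neg_mem (wedgeB_mem_adm_iff.2 hvw)
    rw [← wedgeB_swap] at hwv
    exact (represents_of_left_ne_zero hZ h (wedgeB_mem_adm_iff.1 hwv) hw).swap
  push Not at hv hw
  exact represents_of_mem hZ h hv.2.2.1 hv.1 hv.2.1 hv.2.2.2 hw.2.2.1 hw.1 hw.2.1 hw.2.2.2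

end Closure

/-! ### Quadratic forms through the twisted cubic -/

section LinearSystem

/-- A quadratic form is the diagonal of a bilinear form, by Euler's identity used twice. -/
lemma exists_bilin_of_isHomogeneous {n : ℕ} {q : MvPolynomial (Fin n) ℂ}
    (hq : q.IsHomogeneous 2) : ∃ B : (Fin n → ℂ) →ₗ[ℂ] (Fin n → ℂ) →ₗ[ℂ] ℂ,
      ∀ y, MvPolynomial.aeval (R := ℂ) y q = B y y := by
  have hC : ∀ i j, ∃ c : ℂ, MvPolynomial.pderiv j (MvPolynomial.pderiv i q) =
      MvPolynomial.C c := by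
    intro i j
    have h : (MvPolynomial.pderiv j (MvPolynomial.pderiv i q)).IsHomogeneous 0 := hq.pderiv.pderiv
    rw [← MvPolynomial.totalDegree_zero_iff_isHomogeneous,
      MvPolynomial.totalDegree_eq_zero_iff_eq_C] at h
    exact ⟨_, h⟩
  choose c hc using hC
  refine ⟨(2⁻¹ : ℂ) • ∑ i, ∑ j, c i j • (LinearMap.proj i : Module.Dual ℂ (Fin n → ℂ)).smulRight
    (LinearMap.proj j : Module.Dual ℂ (Fin n → ℂ)), fun y => ?_⟩
  have h1 : ∀ i, MvPolynomial.aeval (R := ℂ) y (MvPolynomial.pderiv i q) = ∑ j, y j * c i j := by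
    intro i
    have h : (MvPolynomial.pderiv i q).IsHomogeneous 1 := hq.pderiv
    have := congrArg (MvPolynomial.aeval (R := ℂ) y) h.sum_X_mul_pderiv
    simpa [hc] using this.symm
  have h2 := congrArg (MvPolynomial.aeval (R := ℂ) y) hq.sum_X_mul_pderiv
  simp only [map_sum, map_mul, MvPolynomial.aeval_X, h1, nsmul_eq_mul,
    Nat.cast_ofNat, map_ofNat] at h2
  simp only [LinearMap.smul_apply, LinearMap.sum_apply, LinearMap.smulRight_apply,
    LinearMap.proj_apply, smul_eq_mul]
  rw [eq_inv_mul_iff_mul_eq₀ two_ne_zero, ← h2]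
  refine Finset.sum_congr rfl fun i _ => ?_
  rw [Finset.mul_sum]
  refine Finset.sum_congr rfl fun j _ => ?_
  ring

lemma bilin_apply_self {n : ℕ} (B : (Fin n → ℂ) →ₗ[ℂ] (Fin n → ℂ) →ₗ[ℂ] ℂ) (y : Fin n → ℂ) :
    B y y = ∑ i, ∑ j, y i * y j * B (Pi.single i 1) (Pi.single j 1) := by
  have h : y = ∑ i, y i • Pi.single i (1 : ℂ) := by
    ext k
    simp [Finset.sum_apply, Pi.single_apply]
  conv_lhs => rw [h]
  rw [LinearMap.map_sum₂]
  simp only [map_sum, map_smul, LinearMap.smul_apply, smul_eq_mul]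
  exact Finset.sum_congr rfl fun i _ => Finset.sum_congr rfl fun j _ => by ring

lemma exists_isHomogeneous_of_bilin {n : ℕ} (B : (Fin n → ℂ) →ₗ[ℂ] (Fin n → ℂ) →ₗ[ℂ] ℂ) :
    ∃ q : MvPolynomial (Fin n) ℂ, q.IsHomogeneous 2 ∧
      ∀ y, MvPolynomial.aeval (R := ℂ) y q = B y y := by
  refine ⟨∑ i, ∑ j, MvPolynomial.C (B (Pi.single i 1) (Pi.single j 1)) *
    (MvPolynomial.X i * MvPolynomial.X j), ?_, fun y => ?_⟩
  · exact MvPolynomial.IsHomogeneous.sum _ _ _ fun i _ =>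
      MvPolynomial.IsHomogeneous.sum _ _ _ fun j _ =>
      ((MvPolynomial.isHomogeneous_X ℂ i).mul (MvPolynomial.isHomogeneous_X ℂ j)).C_mul _
  · rw [bilin_apply_self]
    simp [mul_comm]

lemma isForm_bilin {n : ℕ} (B : (Fin n → ℂ) →ₗ[ℂ] (Fin n → ℂ) →ₗ[ℂ] ℂ) :
    IsForm 2 fun y => B y y := by
  refine ⟨?_, fun c y => by simp; ring⟩
  have h : (fun y => B y y) = ∑ i, ∑ j, (B (Pi.single i 1) (Pi.single j 1)) •
      (((LinearMap.proj i : Module.Dual ℂ (Fin n → ℂ)) : (Fin n → ℂ) → ℂ) *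
        (LinearMap.proj j : Module.Dual ℂ (Fin n → ℂ))) := by
    ext y
    rw [bilin_apply_self]
    simp [Finset.sum_apply, mul_comm]
  rw [h]
  exact (polyFun _).sum_mem fun i _ => (polyFun _).sum_mem fun j _ => (polyFun _).smul_mem
    ((polyFun _).mul_mem (dual_mem_polyFun _) (dual_mem_polyFun _)) _

/-- `phi0` as a map to the span of `Ghat`. -/
def phiW (y : Fin 6 → ℂ) : W := ⟨phi0 y, (isCone_phi0 y).mem_W⟩

lemma exists_bilin_of_dual (l : Module.Dual ℂ W) :
    ∃ B : (Fin 6 → ℂ) →ₗ[ℂ] (Fin 6 → ℂ) →ₗ[ℂ] ℂ, ∀ y, l (phiW y) = B y y := by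
  obtain ⟨l', hl'⟩ := LinearMap.exists_extend l
  refine ⟨(wedgeB.compl₁₂ rowV rowW).compr₂ l', fun y => ?_⟩
  rw [← hl']
  rfl

/-- The affine parametrization `(s, t) ↦ (s²t, 0, 0, -t³, st², -s³)` of the cone over a twisted
cubic. -/
def cubicVec (s t : ℂ) : Fin 6 → ℂ := ![s ^ 2 * t, 0, 0, -t ^ 3, s * t ^ 2, -s ^ 3]

/-- All coordinates of `phi0` vanish on the twisted cubic. -/
lemma phi0_cubicVec (s t : ℂ) : phi0 (cubicVec s t) = 0 := by
  apply eq_zero_of_mem_adm (isCone_phi0 _).mem_adm <;>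
    simp [phi0, rowV_apply, rowW_apply, cubicVec] <;> ring

/-- Every quadratic form vanishing on the twisted cubic is a linear combination of the
coordinates of `phi0`. -/
lemma exists_dual_of_bilin {B : (Fin 6 → ℂ) →ₗ[ℂ] (Fin 6 → ℂ) →ₗ[ℂ] ℂ}
    (hB : ∀ s t, B (cubicVec s t) (cubicVec s t) = 0) :
    ∃ l : Module.Dual ℂ W, ∀ y, l (phiW y) = B y y := by
  have hsum := bilin_apply_self B
  generalize hN : (fun i j => B (Pi.single i 1) (Pi.single j 1)) = N at hsum
  have hN' : ∀ i j, B (Pi.single i 1) (Pi.single j 1) = N i j := fun i j => by rw [← hN]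
  simp only [hN', Fin.sum_univ_six] at hsum
  -- the coefficients of the restriction to the cubic, a binary sextic
  have hpoly : Polynomial.C (N 5 5) * Polynomial.X ^ 6 -
      Polynomial.C (N 0 5 + N 5 0) * Polynomial.X ^ 5 +
      Polynomial.C (N 0 0 - N 4 5 - N 5 4) * Polynomial.X ^ 4 +
      Polynomial.C (N 0 4 + N 4 0 + N 3 5 + N 5 3) * Polynomial.X ^ 3 +
      Polynomial.C (N 4 4 - N 0 3 - N 3 0) * Polynomial.X ^ 2 -
      Polynomial.C (N 3 4 + N 4 3) * Polynomial.X + Polynomial.C (N 3 3) = 0 := by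
    refine Polynomial.funext fun s => ?_
    have h := hB s 1
    rw [hsum] at h
    simp [cubicVec] at h
    simp
    linear_combination h
  have hcoeff : ∀ n, _ := fun n => congrArg (Polynomial.coeff · n) hpoly
  have c0 := hcoeff 0
  have c1 := hcoeff 1
  have c2 := hcoeff 2
  have c3 := hcoeff 3
  have c4 := hcoeff 4
  have c5 := hcoeff 5
  have c6 := hcoeff 6
  simp [Polynomial.coeff_X, Polynomial.coeff_C, Polynomial.coeff_X_pow, -map_add, -map_sub]
    at c0 c1 c2 c3 c4 c5 c6
  let l : Module.Dual ℂ Bivec := (N 0 2 + N 2 0) • pl 0 2 + (N 1 2 + N 2 1) • pl 0 3 +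
    N 2 2 • pl 0 4 + (N 2 3 + N 3 2) • pl 0 5 + (N 2 4 + N 4 2) • pl 0 6 +
    (N 2 5 + N 5 2) • pl 2 4 - (N 0 1 + N 1 0) • pl 1 2 - N 1 1 • pl 1 3 -
    (N 1 3 + N 3 1) • pl 1 5 - (N 1 4 + N 4 1) • pl 1 6 + (N 1 5 + N 5 1) • pl 2 3 +
    (N 3 5 + N 5 3) • pl 2 5 + N 0 0 • pl 2 6 + N 4 4 • pl 5 6
  refine ⟨l ∘ₗ W.subtype, fun y => ?_⟩
  have hl : (l ∘ₗ W.subtype) (phiW y) = l (phi0 y) := rfl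
  rw [hl, hsum]
  simp [l, phi0, rowV_apply, rowW_apply]
  linear_combination -(y 0 * y 4) * c3 + y 4 * y 5 * c4 + y 0 * y 3 * c2 + y 3 * y 4 * c1 +
    y 0 * y 5 * c5 - y 3 ^ 2 * c0 - y 5 ^ 2 * c6

end LinearSystem

/-! ### The linear system and the span of `Ghat` -/

section Identification

variable (A : (Fin 6 → ℂ) ≃ₗ[ℂ] (Fin 6 → ℂ))

/-- The basis of the span of the twisted cubic in the standard coordinates. -/
def cubicBasis : Fin 4 → (Fin 6 → ℂ) :=
  ![-Pi.single 5 1, Pi.single 0 1, Pi.single 4 1, -Pi.single 3 1]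

lemma sum_cubicBasis (s t : ℂ) : s ^ 3 • cubicBasis 0 + (s ^ 2 * t) • cubicBasis 1 +
    (s * t ^ 2) • cubicBasis 2 + t ^ 3 • cubicBasis 3 = cubicVec s t := by
  ext i
  fin_cases i <;> simp [cubicBasis, cubicVec]

lemma linearIndependent_cubicBasis : LinearIndependent ℂ cubicBasis := by
  rw [Fintype.linearIndependent_iff]
  intro g hg
  rw [Fin.sum_univ_four] at hg
  have h0 := congrFun hg 5
  have h1 := congrFun hg 0
  have h2 := congrFun hg 4
  have h3 := congrFun hg 3
  simp [cubicBasis] at h0 h1 h2 h3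
  intro i
  fin_cases i <;> assumption

/-- The twisted cubic in `ℙ⁵`, in the linear coordinates `A`. -/
def cubic : Set (ℙ ℂ (Fin 6 → ℂ)) :=
  {p | ∃ (s t : ℂ) (h : A.symm (cubicVec s t) ≠ 0), Projectivization.mk ℂ _ h = p}

lemma isTwistedCubic_cubic : IsTwistedCubic (cubic A) := by
  refine ⟨fun k => A.symm (cubicBasis k), ?_, ?_⟩
  · exact linearIndependent_cubicBasis.map' A.symm.toLinearMap A.symm.ker
  · have h : ∀ s t : ℂ, s ^ 3 • A.symm (cubicBasis 0) + (s ^ 2 * t) • A.symm (cubicBasis 1) +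
        (s * t ^ 2) • A.symm (cubicBasis 2) + t ^ 3 • A.symm (cubicBasis 3) =
        A.symm (cubicVec s t) := fun s t => by
      rw [← sum_cubicBasis]
      simp only [map_add, map_smul]
    simp only [h]
    rfl

lemma mem_quadrics_iff {q : MvPolynomial (Fin 6) ℂ} : q ∈ quadrics (cubic A) ↔
    q.IsHomogeneous 2 ∧ ∀ s t, MvPolynomial.aeval (R := ℂ) (A.symm (cubicVec s t)) q = 0 := by
  rw [quadrics, Submodule.mem_inf, MvPolynomial.mem_homogeneousSubmodule]
  refine and_congr_right fun hq => ?_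
  obtain ⟨B, hB⟩ := exists_bilin_of_isHomogeneous hq
  simp only [Submodule.mem_iInf, LinearMap.mem_ker, AlgHom.toLinearMap_apply, hB]
  constructor
  · intro h s t
    by_cases h0 : A.symm (cubicVec s t) = 0
    · simp [h0]
    · have := h _ ⟨s, t, h0, rfl⟩
      by_contra hne
      exact ((isForm_bilin B).rep_mk_ne_zero_iff h0).2 hne this
  · rintro h _ ⟨s, t, h0, rfl⟩
    by_contra hne
    exact ((isForm_bilin B).rep_mk_ne_zero_iff h0).1 hne (h s t)

lemma dual_eq_zero_of_phiW {l : Module.Dual ℂ W} (h : ∀ y, l (phiW y) = 0) : l = 0 := by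
  have hle : adm ≤ (LinearMap.ker l).map W.subtype := adm_le fun y => ⟨phiW y, h y, rfl⟩
  ext ⟨b, hb⟩
  obtain ⟨b', hb', he⟩ := hle (W_eq_adm ▸ hb)
  have : b' = ⟨b, hb⟩ := Subtype.ext he
  rw [← this]
  exact hb'

/-- The quadratic functions of the form `l ∘ phi0`, in the coordinates `A`. -/
def dualToFun : Module.Dual ℂ W →ₗ[ℂ] (Fin 6 → ℂ) → ℂ :=
  LinearMap.pi fun y => Module.Dual.eval ℂ W (phiW (A y))

/-- The quadrics through the twisted cubic as functions on `ℂ⁶`. -/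
def quadricsToFun : quadrics (cubic A) →ₗ[ℂ] (Fin 6 → ℂ) → ℂ :=
  LinearMap.pi fun y => (MvPolynomial.aeval (R := ℂ) y).toLinearMap ∘ₗ (quadrics (cubic A)).subtype

lemma dualToFun_apply (l : Module.Dual ℂ W) (y : Fin 6 → ℂ) :
    dualToFun A l y = l (phiW (A y)) := rfl

lemma quadricsToFun_apply (q : quadrics (cubic A)) (y : Fin 6 → ℂ) :
    quadricsToFun A q y = MvPolynomial.aeval (R := ℂ) y (q : MvPolynomial (Fin 6) ℂ) := rfl

lemma dualToFun_injective : Function.Injective (dualToFun A) := by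
  rw [injective_iff_map_eq_zero]
  intro l hl
  refine dual_eq_zero_of_phiW fun y => ?_
  have := congrFun hl (A.symm y)
  rwa [dualToFun_apply, A.apply_symm_apply] at this

lemma quadricsToFun_injective : Function.Injective (quadricsToFun A) := by
  intro q q' h
  refine Subtype.ext (MvPolynomial.funext fun y => ?_)
  exact congrFun h y

/-- The coordinates of `phi0` are exactly the quadrics through the twisted cubic. -/
lemma range_dualToFun : LinearMap.range (dualToFun A) = LinearMap.range (quadricsToFun A) := by
  apply le_antisymm
  · rintro _ ⟨l, rfl⟩
    obtain ⟨B, hB⟩ := exists_bilin_of_dual l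
    obtain ⟨q, hq, hqB⟩ := exists_isHomogeneous_of_bilin
      (B.compl₁₂ A.toLinearMap A.toLinearMap)
    refine ⟨⟨q, (mem_quadrics_iff A).2 ⟨hq, fun s t => ?_⟩⟩, ?_⟩
    · rw [hqB]
      simp only [LinearMap.compl₁₂_apply, LinearEquiv.coe_coe, LinearEquiv.apply_symm_apply]
      rw [← hB, show phiW (cubicVec s t) = 0 from Subtype.ext (phi0_cubicVec s t), map_zero]
    · ext y
      rw [quadricsToFun_apply, dualToFun_apply, hqB, hB]
      rfl
  · rintro _ ⟨⟨q, hq⟩, rfl⟩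
    obtain ⟨hq2, hq0⟩ := (mem_quadrics_iff A).1 hq
    obtain ⟨B, hB⟩ := exists_bilin_of_isHomogeneous hq2
    obtain ⟨l, hl⟩ := exists_dual_of_bilin
      (B := B.compl₁₂ A.symm.toLinearMap A.symm.toLinearMap) fun s t => by
        rw [← hq0 s t, hB]; rfl
    refine ⟨l, ?_⟩
    ext y
    rw [quadricsToFun_apply, dualToFun_apply, hB, hl]
    simp

/-- The linear forms on the span of `Ghat` are identified with the quadrics through the twisted
cubic by composition with `phi0`. -/
def dualEquiv : Module.Dual ℂ W ≃ₗ[ℂ] quadrics (cubic A) :=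
  LinearEquiv.ofInjective _ (dualToFun_injective A) ≪≫ₗ
    LinearEquiv.ofEq _ _ (range_dualToFun A) ≪≫ₗ
    (LinearEquiv.ofInjective _ (quadricsToFun_injective A)).symm

lemma aeval_dualEquiv (l : Module.Dual ℂ W) (y : Fin 6 → ℂ) :
    MvPolynomial.aeval (R := ℂ) y (dualEquiv A l : MvPolynomial (Fin 6) ℂ) = l (phiW (A y)) := by
  have h : quadricsToFun A (dualEquiv A l) = dualToFun A l := by
    have h1 := LinearEquiv.apply_symm_apply
      (LinearEquiv.ofInjective _ (quadricsToFun_injective A))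
      (LinearEquiv.ofEq _ _ (range_dualToFun A)
        (LinearEquiv.ofInjective _ (dualToFun_injective A) l))
    exact congrArg Subtype.val h1
  exact congrFun h y

instance : Module.Finite ℂ Bivec := inferInstanceAs (Module.Finite ℂ (⋀[ℂ]^2 V))

/-- The identification of the target of the linear system with the span of `Ghat`: the transpose
of `dualEquiv`, up to the identification of `W` with its double dual. -/
def spanEquiv : Module.Dual ℂ (quadrics (cubic A)) ≃ₗ[ℂ] W :=
  (dualEquiv A).dualMap ≪≫ₗ (Module.evalEquiv ℂ W).symm

lemma phi_eq (y : Fin 6 → ℂ) : phi (cubic A) (spanEquiv A) y = phiW (A y) := by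
  rw [phi, spanEquiv, LinearEquiv.trans_apply, LinearEquiv.symm_apply_eq]
  ext l
  rw [Module.evalEquiv_apply]
  exact aeval_dualEquiv A l y

lemma isFormMap_phi : IsFormMap 2 (phi (cubic A) (spanEquiv A)) := by
  intro l
  obtain ⟨B, hB⟩ := exists_bilin_of_dual l
  have h := isForm_bilin (B.compl₁₂ A.toLinearMap A.toLinearMap)
  simp only [phi_eq, hB]
  exact h

end Identification

/-! ### The projection from `F` -/

section Projection

/-- `pi0` restricted to the span of `Ghat`. -/
def piW : W →ₗ[ℂ] (Fin 6 → ℂ) := pi0 ∘ₗ W.subtype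

lemma piW_phiW (y : Fin 6 → ℂ) : piW (phiW y) = y 2 • y := pi0_phi0 y

lemma ker_piW : LinearMap.ker piW = spanF := by
  ext ⟨b, hb⟩
  rw [Submodule.mem_comap]
  change pi0 b = 0 ↔ b ∈ linSpan F
  rw [mem_linSpan_F_iff, ← W_eq_adm]
  simp [hb]

lemma piW_surjective : Function.Surjective piW := by
  intro z
  refine ⟨phiW (Function.update z 2 1) + (z 2 - 1) • phiW (Pi.single 2 1), ?_⟩
  ext i
  by_cases hi : i = 2
  · subst hi
    simp [piW_phiW]
  · simp [piW_phiW, hi]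

/-- The linear coordinates on the quotient given by `pi0`. -/
def quotEquiv : (W ⧸ spanF) ≃ₗ[ℂ] (Fin 6 → ℂ) :=
  Submodule.quotEquivOfEq _ _ ker_piW.symm ≪≫ₗ
    LinearMap.quotKerEquivOfSurjective piW piW_surjective

lemma quotEquiv_mkQ (b : W) : quotEquiv (spanF.mkQ b) = piW b := rfl

lemma isFormMap_projF (θ : (W ⧸ spanF) ≃ₗ[ℂ] (Fin 6 → ℂ)) : IsFormMap 1 (projF θ) := fun l =>
  isForm_dual (l ∘ₗ θ.toLinearMap ∘ₗ spanF.mkQ)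

end Projection

/-! ### The birational map and its inverse -/

section Birational

variable (θ : (W ⧸ spanF) ≃ₗ[ℂ] (Fin 6 → ℂ))

/-- The change from the coordinates `θ` to the coordinates given by `pi0`. -/
def coordChange : (Fin 6 → ℂ) ≃ₗ[ℂ] (Fin 6 → ℂ) := θ.symm ≪≫ₗ quotEquiv

lemma coordChange_projF (b : W) : coordChange θ (projF θ b) = piW b := by
  rw [← quotEquiv_mkQ]
  simp [coordChange, projF]

lemma projF_eq (b : W) : projF θ b = (coordChange θ).symm (piW b) := by
  rw [← coordChange_projF θ, LinearEquiv.symm_apply_apply]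

/-- The map given by the quadrics through the twisted cubic in the coordinates `θ`. -/
def phiθ : (Fin 6 → ℂ) → W := phi (cubic (coordChange θ)) (spanEquiv (coordChange θ))

lemma isFormMap_phiθ : IsFormMap 2 (phiθ θ) := isFormMap_phi _

lemma phiθ_apply (y : Fin 6 → ℂ) : phiθ θ y = phiW (coordChange θ y) := phi_eq _ y

lemma phiθ_projF {b : W} (hb : IsCone (b : Bivec)) : phiθ θ (projF θ b) = pl 0 4 b • b := by
  rw [phiθ_apply, coordChange_projF]
  exact Subtype.ext hb.phi0_pi0

lemma projF_phiθ (y : Fin 6 → ℂ) : projF θ (phiθ θ y) = coordChange θ y 2 • y := by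
  rw [projF_eq, phiθ_apply, piW_phiW, map_smul, LinearEquiv.symm_apply_apply]

lemma projF_ne_zero {b : W} (h : pl 0 4 (b : Bivec) ≠ 0) : projF θ b ≠ 0 := by
  intro h0
  have h1 := coordChange_projF θ b
  rw [h0, map_zero] at h1
  exact h (congrFun h1 2).symm

lemma sends_phiθ {b : W} (hb0 : b ≠ 0) (hb : IsCone (b : Bivec)) (h : pl 0 4 (b : Bivec) ≠ 0) :
    Sends (phiθ θ) (Projectivization.mk ℂ _ (projF_ne_zero θ h)) (Projectivization.mk ℂ b hb0) := by
  rw [sends_mk_iff (isFormMap_phiθ θ)]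
  refine ⟨by rw [phiθ_projF θ hb]; exact smul_ne_zero h hb0, ?_⟩
  rw [Projectivization.mk_eq_mk_iff']
  exact ⟨_, (phiθ_projF θ hb).symm⟩

lemma sends_projF {p : ℙ ℂ W} {q : ℙ ℂ (Fin 6 → ℂ)} (h : coordChange θ q.rep 2 ≠ 0)
    (hqp : Sends (phiθ θ) q p) : Sends (projF θ) p q := by
  obtain ⟨h0, rfl⟩ := hqp
  rw [sends_mk_iff (isFormMap_projF θ)]
  refine ⟨by rw [projF_phiθ]; exact smul_ne_zero h q.rep_nonzero, ?_⟩
  conv_rhs => rw [← q.mk_rep]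
  rw [Projectivization.mk_eq_mk_iff']
  exact ⟨_, (projF_phiθ θ _).symm⟩

lemma phiθ_ne_zero {y : Fin 6 → ℂ} (h : coordChange θ y 2 ≠ 0) : phiθ θ y ≠ 0 := by
  intro h0
  have h1 := projF_phiθ θ y
  rw [h0, projF_eq, map_zero, map_zero] at h1
  rcases smul_eq_zero.1 h1.symm with h2 | h2
  · exact h h2
  · exact h (by simp [h2])

lemma pl_phiθ (y : Fin 6 → ℂ) : pl 0 4 (phiθ θ y : Bivec) = coordChange θ y 2 ^ 2 := by
  rw [phiθ_apply, pow_two]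
  exact congrFun (pi0_phi0 (coordChange θ y)) 2

/-- `Ghat` is the closure of the image of the rational map given by the quadrics. -/
lemma GhatW_eq_closure :
    GhatW = @closure _ (zariski W) {p | ∃ y : ℙ ℂ (Fin 6 → ℂ), Sends (phiθ θ) y p} := by
  let _ := zariski W
  apply subset_antisymm
  · intro p hp
    rw [mem_GhatW_iff] at hp
    have key := represents_of_isCone (Z := closure {p | ∃ y, Sends (phiθ θ) y p})
      isClosed_closure (fun b hb hne hbW h0 =>
        subset_closure ⟨_, sends_phiθ θ h0 hb hne⟩) hp p.rep.2 p.rep_nonzero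
    rwa [← p.mk_rep]
  · refine closure_minimal ?_ isClosed_GhatW
    rintro _ ⟨y, h, rfl⟩
    rw [mk_mem_GhatW_iff, phiθ_apply]
    exact isCone_phi0 _

lemma exists_coordChange_ne_zero : ∃ y : Fin 6 → ℂ, coordChange θ y 2 ≠ 0 :=
  ⟨(coordChange θ).symm (Pi.single 2 1), by simp⟩

lemma isProjVariety_GhatW : IsProjVariety GhatW := by
  let _ := zariski W
  refine ⟨isClosed_GhatW, ?_⟩
  rw [GhatW_eq_closure quotEquiv]
  obtain ⟨y, hy⟩ := exists_coordChange_ne_zero quotEquiv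
  exact (isIrreducible_image (isFormMap_phiθ _)
    ⟨y, fun h0 => hy (by simp [h0]), phiθ_ne_zero _ hy⟩).closure

lemma isProjVariety_univ : IsProjVariety (Set.univ : Set (ℙ ℂ (Fin 6 → ℂ))) := by
  let _ := zariski (Fin 6 → ℂ)
  refine ⟨isClosed_univ, ?_⟩
  have h := isIrreducible_image (g := (id : (Fin 6 → ℂ) → (Fin 6 → ℂ))) (d := 1)
    (fun l => isForm_dual l) ⟨Pi.single 0 1, by simp, by simp⟩
  convert h
  refine (Set.eq_univ_of_forall fun p => ?_).symm
  exact ⟨p, p.rep_nonzero, p.mk_rep⟩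

lemma birationalInverse : BirationalInverse GhatW Set.univ (projF θ) (phiθ θ) := by
  let U : Set (ℙ ℂ W) := {p | (pl 0 4 ∘ₗ W.subtype) p.rep ≠ 0}
  let l : Module.Dual ℂ (Fin 6 → ℂ) := LinearMap.proj 2 ∘ₗ (coordChange θ).toLinearMap
  let U' : Set (ℙ ℂ (Fin 6 → ℂ)) := {q | l q.rep ≠ 0}
  have hU : ∀ {b : W} (hb : b ≠ 0), Projectivization.mk ℂ b hb ∈ U ↔ pl 0 4 (b : Bivec) ≠ 0 :=
    fun hb => (isForm_dual (pl 0 4 ∘ₗ W.subtype)).rep_mk_ne_zero_iff hb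
  have hU' : ∀ {y} (hy : y ≠ 0), Projectivization.mk ℂ y hy ∈ U' ↔ coordChange θ y 2 ≠ 0 :=
    fun hy => (isForm_dual l).rep_mk_ne_zero_iff hy
  have h1 : ∀ p ∈ GhatW ∩ U, ∃ q ∈ Set.univ ∩ U', Sends (projF θ) p q ∧ Sends (phiθ θ) q p := by
    rintro p ⟨hp, hpU⟩
    rw [mem_GhatW_iff] at hp
    refine ⟨Projectivization.mk ℂ _ (projF_ne_zero θ hpU), ⟨trivial, ?_⟩, ⟨_, rfl⟩, ?_⟩
    · rw [hU', coordChange_projF]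
      exact hpU
    · have := sends_phiθ θ p.rep_nonzero hp hpU
      rwa [p.mk_rep] at this
  have h2 : ∀ q ∈ Set.univ ∩ U', ∃ p ∈ GhatW ∩ U, Sends (phiθ θ) q p ∧ Sends (projF θ) p q := by
    rintro q ⟨-, hq⟩
    have hq2 : coordChange θ q.rep 2 ≠ 0 := hq
    have hs : Sends (phiθ θ) q (Projectivization.mk ℂ _ (phiθ_ne_zero θ hq2)) := ⟨_, rfl⟩
    refine ⟨_, ⟨?_, ?_⟩, hs, sends_projF θ hq2 hs⟩
    · rw [mk_mem_GhatW_iff, phiθ_apply]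
      exact isCone_phi0 _
    · rw [hU, pl_phiθ]
      exact pow_ne_zero 2 hq2
  obtain ⟨y, hy⟩ := exists_coordChange_ne_zero θ
  have hne : (Set.univ ∩ U').Nonempty :=
    ⟨Projectivization.mk ℂ y fun h0 => hy (by simp [h0]), trivial, (hU' _).2 hy⟩
  refine ⟨isProjVariety_GhatW, isProjVariety_univ, ⟨1, isFormMap_projF θ⟩, ⟨2, isFormMap_phiθ θ⟩,
    U, U', (isForm_dual (pl 0 4 ∘ₗ W.subtype)).isOpen, (isForm_dual l).isOpen, ?_, hne, h1, h2⟩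
  obtain ⟨q, hq⟩ := hne
  obtain ⟨p, hp, -⟩ := h2 q hq
  exact ⟨p, hp⟩

end Birational

end HatG2

end

theorem mainTheorem3 :
    Module.finrank ℂ (HatG2.W ⧸ HatG2.spanF) = 6 ∧
    ∀ θ : (HatG2.W ⧸ HatG2.spanF) ≃ₗ[ℂ] (Fin 6 → ℂ),
      ∃ C : Set (ℙ ℂ (Fin 6 → ℂ)), HatG2.IsTwistedCubic C ∧
        ∃ β : Module.Dual ℂ (HatG2.quadrics C) ≃ₗ[ℂ] HatG2.W,
          HatG2.BirationalInverse HatG2.GhatW Set.univ (HatG2.projF θ) (HatG2.phi C β) ∧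
          HatG2.GhatW = @closure _ (HatG2.zariski HatG2.W)
            {p | ∃ y : ℙ ℂ (Fin 6 → ℂ), HatG2.Sends (HatG2.phi C β) y p} := by
  refine ⟨by rw [HatG2.quotEquiv.finrank_eq]; simp, fun θ => ?_⟩
  exact ⟨HatG2.cubic (HatG2.coordChange θ), HatG2.isTwistedCubic_cubic _,
    HatG2.spanEquiv (HatG2.coordChange θ), HatG2.birationalInverse θ, HatG2.GhatW_eq_closure θ⟩
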